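/- Let $\mathbb Z[i]$ be the ring of Gaussian integers and, for real $x$, let $\mathbb B_x(i)=\{\omega\in\mathbb Z[i] : |\omega|^2\le x\}$. Let $\Lambda_i:\mathbb Z[i]\to\mathbb R$ be the generalized Mangoldt function: $\Lambda_i(\omega)=\ln|\mathfrak p|$ if $\omega=\mathfrak u\,\mathfrak p^{\nu}$ for a unit $\mathfrak u$, a prime element $\mathfrak p$ of $\mathbb Z[i]$ and an integer $\nu\ge 1$, and $\Lambda_i(\omega)=0$ if $\omega$ is not of this form. Let $\arg\omega\in(-\pi,\pi]$ be the principal argument of $\omega \neq 0$ (the value of $\arg 0$ is irrelevant, as $\Lambda_i(0)=0$). Then, as $x\to\infty$ through the real numbers, $$\psi_i(x):=\sum_{\omega\in\mathbb B_x(i)}\Lambda_i(\omega)\sim 2x,$$ and, for every integer $h\neq 0$, $$\sum_{\omega\in\mathbb B_x(i)}e^{4ih\arg\omega}\,\Lambda_i(\omega)=o(x).$$ -/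

import Mathlib

open Filter Asymptotics

/-- The set `{ω ∈ ℤ[i] : |ω|² ≤ x}` is finite. -/
theorem finite_gaussianDisc (x : ℝ) : {ω : GaussianInt | ‖(ω : ℂ)‖ ^ 2 ≤ x}.Finite := by
  have hfin : ((Finset.Icc (-⌈x⌉) ⌈x⌉ ×ˢ Finset.Icc (-⌈x⌉) ⌈x⌉ : Finset (ℤ × ℤ)) :
      Set (ℤ × ℤ)).Finite := Finset.finite_toSet _
  refine (hfin.image (fun q => (⟨q.1, q.2⟩ : GaussianInt))).subset ?_
  intro ω hω
  have h1 : (ω.re : ℝ) ^ 2 + (ω.im : ℝ) ^ 2 ≤ x := by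
    have h2 : ‖(ω : ℂ)‖ ^ 2 ≤ x := hω
    rw [Complex.sq_norm, Complex.normSq_apply, ← GaussianInt.intCast_re,
      ← GaussianInt.intCast_im] at h2
    nlinarith [h2]
  have h3 : ω.re ^ 2 + ω.im ^ 2 ≤ ⌈x⌉ := by
    have h4 := h1.trans (Int.le_ceil x)
    exact_mod_cast h4
  refine ⟨(ω.re, ω.im), ?_, rfl⟩
  simp only [Finset.coe_product, Finset.coe_Icc, Set.mem_prod, Set.mem_Icc]
  have hr1 := Int.le_self_sq ω.re
  have hr2 := Int.le_self_sq (-ω.re)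
  have hi1 := Int.le_self_sq ω.im
  have hi2 := Int.le_self_sq (-ω.im)
  refine ⟨⟨?_, ?_⟩, ?_, ?_⟩ <;> nlinarith [sq_nonneg ω.re, sq_nonneg ω.im]

/-- The finite set of all Gaussian integers `ω` with `|ω|² ≤ x`. -/
noncomputable def gaussianDisc (x : ℝ) : Finset GaussianInt :=
  (finite_gaussianDisc x).toFinset

theorem mem_gaussianDisc {x : ℝ} {ω : GaussianInt} : ω ∈ gaussianDisc x ↔ ‖(ω : ℂ)‖ ^ 2 ≤ x := by
  simp [gaussianDisc]

/-- `ω = u * p ^ ν` for some unit `u` and some exponent `ν ≥ 1`, with `p` a Gaussian prime. -/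
def IsUnitMulPrimePow (p ω : GaussianInt) : Prop :=
  Prime p ∧ ∃ u : GaussianInt, IsUnit u ∧ ∃ ν : ℕ, 1 ≤ ν ∧ ω = u * p ^ ν

open Classical in
/-- The generalized Mangoldt function on `ℤ[i]`: its value at `ω` is `log |p|` if
`ω = u * p ^ ν` with a unit `u`, a prime `p` and `ν ≥ 1`, and `0` if `ω` is not of this form.
The two theorems below show that the value does not depend on the choice of `p`. -/
noncomputable def gaussianMangoldt (ω : GaussianInt) : ℝ :=
  if hω : ∃ p : GaussianInt, IsUnitMulPrimePow p ω then Real.log ‖(hω.choose : ℂ)‖ else 0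

theorem gaussianMangoldt_eq_log {p ω : GaussianInt} (hp : IsUnitMulPrimePow p ω) :
    gaussianMangoldt ω = Real.log ‖(p : ℂ)‖ := by
  have hω : ∃ p : GaussianInt, IsUnitMulPrimePow p ω := ⟨p, hp⟩
  rw [gaussianMangoldt, dif_pos hω]
  obtain ⟨hq, v, hv, m, hm, hqe⟩ := hω.choose_spec
  generalize hω.choose = q at hq hqe ⊢
  obtain ⟨hpp, u, hu, n, hn, hpe⟩ := hp
  have hdvd : p ∣ v * q ^ m := by
    rw [← hqe, hpe]
    exact (dvd_pow_self p (by omega)).mul_left u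
  have hpq : p ∣ q := by
    rcases hpp.dvd_or_dvd hdvd with h | h
    · exact absurd (isUnit_of_dvd_unit h hv) hpp.not_isUnit
    · exact hpp.dvd_of_dvd_pow h
  obtain ⟨w, hw⟩ := (hpp.dvd_prime_iff_associated hq).1 hpq
  have hwu : ‖((w : GaussianInt) : ℂ)‖ = 1 := by
    have h1 : Zsqrtd.norm (w : GaussianInt) = 1 :=
      (Zsqrtd.norm_eq_one_iff' (by norm_num) (w : GaussianInt)).2 w.isUnit
    have h2 := GaussianInt.intCast_real_norm (w : GaussianInt)
    rw [h1, Complex.normSq_eq_norm_sq] at h2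
    have h3 := norm_nonneg ((w : GaussianInt) : ℂ)
    push_cast at h2
    nlinarith
  rw [← hw, GaussianInt.toComplex_mul, norm_mul, hwu, mul_one]

theorem gaussianMangoldt_eq_zero {ω : GaussianInt} (hω : ¬ ∃ p : GaussianInt, IsUnitMulPrimePow p ω) :
    gaussianMangoldt ω = 0 := by
  rw [gaussianMangoldt, dif_neg hω]

/-- `ψ_i(x)`, the sum of the generalized Mangoldt function over `|ω|² ≤ x`. -/
noncomputable def gaussianPsi (x : ℝ) : ℝ :=
  ∑ ω ∈ gaussianDisc x, gaussianMangoldt ω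

/-!
Wiener–Ikehara applied to the Hecke `L`-functions `L_h(s) = ∑ (ω / |ω|) ^ (4 h) |ω| ^ (-2 s)`, where
`ω` runs over the nonzero Gaussian integers.

Multiplication by `α ≠ 0` multiplies the terms of `L_h` by a constant, so comparing `L_h` with
itself along the residue classes modulo `α` writes `(N α · χ(α) |α| ^ (-2 s) - 1) L_h(s)` as a
finite sum of differences of series over two residue classes, and these converge for
`re s > 1 / 2`. Hence `L_h` has an order of vanishing at every point of the line `re s = 1`.
Varying `α` shows that this order is nonnegative, except at the simple pole of `L_0` at `1`, and
the inequality `3 + 4 cos θ + cos 2θ ≥ 0` shows that it is zero. So `-2 L_h' / L_h`, the Dirichlet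
series of `Λ(ω) (ω / |ω|) ^ (4 h)`, extends continuously to `re s = 1` apart from a simple pole of
residue `2` at `s = 1` when `h = 0`. The factor `2` comes from the four associates of each prime
power, weighed against `Λ` being `log |p|` rather than `log |p| ^ 2`.
-/

open Topology MeasureTheory

/-! ### Fejér kernels -/

theorem integral_one_sub_mul_cexp {w : ℂ} (hw : w ≠ 0) :
    ∫ t in (0 : ℝ)..1, (1 - t : ℂ) * Complex.exp (t * w) = (Complex.exp w - 1 - w) / w ^ 2 := by
  have hderiv (t : ℝ) : HasDerivAt
      (fun t : ℝ ↦ (1 - t : ℂ) * Complex.exp (t * w) / w + Complex.exp (t * w) / w ^ 2)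
      ((1 - t : ℂ) * Complex.exp (t * w)) t := by
    have hid : HasDerivAt (fun t : ℝ ↦ (t : ℂ)) 1 t := (hasDerivAt_id (t : ℂ)).comp_ofReal
    have hexp := (hid.mul_const w).cexp
    refine ((((hid.const_sub 1).mul hexp).div_const w).add (hexp.div_const (w ^ 2))).congr_deriv ?_
    field_simp
    ring
  rw [intervalIntegral.integral_eq_sub_of_hasDerivAt (fun t _ ↦ hderiv t)
    (Continuous.intervalIntegrable (by fun_prop) _ _)]
  field_simp
  simp
  ring

theorem integral_one_sub_abs_mul_cexp (y : ℝ) :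
    ∫ t in (-1 : ℝ)..1, ((1 - |t| : ℝ) : ℂ) * Complex.exp (Complex.I * t * y) =
      ((Real.sinc (y / 2) ^ 2 : ℝ) : ℂ) := by
  have hint (a b z : ℝ) : IntervalIntegrable
      (fun t : ℝ ↦ ((1 - |t| : ℝ) : ℂ) * Complex.exp (Complex.I * t * z)) volume a b :=
    Continuous.intervalIntegrable (by fun_prop) a b
  have hright (z : ℝ) : ∫ t in (0 : ℝ)..1, ((1 - |t| : ℝ) : ℂ) * Complex.exp (Complex.I * t * z) =
      ∫ t in (0 : ℝ)..1, (1 - t : ℂ) * Complex.exp (t * (Complex.I * z)) := by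
    refine intervalIntegral.integral_congr fun t ht ↦ ?_
    rw [Set.uIcc_of_le zero_le_one] at ht
    simp only [abs_of_nonneg ht.1]
    push_cast
    ring_nf
  have hleft : ∫ t in (-1 : ℝ)..0, ((1 - |t| : ℝ) : ℂ) * Complex.exp (Complex.I * t * y) =
      ∫ t in (0 : ℝ)..1, ((1 - |t| : ℝ) : ℂ) * Complex.exp (Complex.I * t * (-y : ℝ)) := by
    rw [← neg_zero, ← intervalIntegral.integral_comp_neg, neg_zero]
    refine intervalIntegral.integral_congr fun t _ ↦ ?_
    simp
  rw [← intervalIntegral.integral_add_adjacent_intervals (hint _ 0 _) (hint _ _ _), hleft,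
    hright, hright]
  rcases eq_or_ne y 0 with rfl | hy
  · have hhalf : ∫ t in (0 : ℝ)..1, (1 - t : ℂ) = 1 / 2 := by
      have h : ∫ t in (0 : ℝ)..1, ((1 - t : ℝ) : ℂ) = 1 / 2 := by
        rw [intervalIntegral.integral_ofReal, intervalIntegral.integral_sub (by simp) (by simp)]
        simp
        norm_num
      simpa using h
    simp [hhalf]
    norm_num
  · have hy' : (y : ℂ) ≠ 0 := by exact_mod_cast hy
    have hsin : Real.sin (y / 2) ^ 2 = (1 - Real.cos y) / 2 := by
      rw [Real.sin_sq_eq_half_sub]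
      ring_nf
    rw [integral_one_sub_mul_cexp (by simpa using hy),
      integral_one_sub_mul_cexp (by simpa using hy), Real.sinc_of_ne_zero (by positivity), div_pow,
      hsin]
    push_cast
    rw [Complex.cos, mul_pow, mul_pow, Complex.I_sq, mul_comm Complex.I, mul_comm Complex.I]
    field_simp
    ring

theorem integrable_sinc_sq : Integrable fun y : ℝ ↦ Real.sinc y ^ 2 := by
  refine (integrable_inv_one_add_sq.const_mul 2).mono' (by fun_prop) (ae_of_all _ fun y ↦ ?_)
  rw [Real.norm_of_nonneg (sq_nonneg _), ← div_eq_mul_inv, le_div_iff₀ (by positivity)]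
  have hle : Real.sinc y ^ 2 ≤ 1 := by
    rw [sq_le_one_iff_abs_le_one]
    exact abs_le.2 ⟨Real.neg_one_le_sinc y, Real.sinc_le_one y⟩
  have hdecay : Real.sinc y ^ 2 * y ^ 2 ≤ 1 := by
    rcases eq_or_ne y 0 with rfl | hy
    · simp
    · rw [Real.sinc_of_ne_zero hy, div_pow, div_mul_cancel₀ _ (by positivity)]
      exact Real.sin_sq_le_one y
  linarith

/-- A nonnegative integrable kernel `k` that is the Fourier transform of a continuous function `φ`
with compact support. The transform is normalised as `∫ φ t * exp (i t y)`. -/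
structure IsBandLimitedKernel (φ k : ℝ → ℝ) : Prop where
  continuous : Continuous φ
  hasCompactSupport : HasCompactSupport φ
  nonneg : ∀ y, 0 ≤ k y
  integrable : Integrable k
  fourier_eq : ∀ y : ℝ, ∫ t, (φ t : ℂ) * Complex.exp (Complex.I * t * y) = k y

/-- A probability density `k` on the line giving mass at least `1 - δ` to the interval
`[-δ, δ]`. -/
structure IsConcentratedDensity (δ : ℝ) (k : ℝ → ℝ) : Prop where
  nonneg : ∀ y, 0 ≤ k y
  integrable : Integrable k
  integral_eq_one : ∫ y, k y = 1
  one_sub_le : 1 - δ ≤ ∫ y in (-δ)..δ, k y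

theorem norm_cexp_I_mul_mul (t y : ℝ) : ‖Complex.exp (Complex.I * t * y)‖ = 1 := by
  rw [mul_assoc, mul_comm, ← Complex.ofReal_mul, Complex.norm_exp_ofReal_mul_I]

namespace IsBandLimitedKernel

variable {φ k : ℝ → ℝ}

theorem integrable_transform (h : IsBandLimitedKernel φ k) : Integrable φ :=
  h.continuous.integrable_of_hasCompactSupport h.hasCompactSupport

theorem norm_le (h : IsBandLimitedKernel φ k) (y : ℝ) : ‖k y‖ ≤ ∫ t, ‖φ t‖ := by
  rw [← Complex.norm_real, ← h.fourier_eq]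
  refine (norm_integral_le_integral_norm _).trans_eq (integral_congr_ae (ae_of_all _ fun t ↦ ?_))
  simp [norm_cexp_I_mul_mul]

theorem integrableOn_mul_comp_sub (h : IsBandLimitedKernel φ k) {f : ℝ → ℝ} {s : Set ℝ}
    (hf : IntegrableOn f s) (v : ℝ) : IntegrableOn (fun u ↦ f u * k (v - u)) s :=
  Integrable.mul_bdd hf (h.integrable.comp_sub_left v).integrableOn.aestronglyMeasurable
    (ae_of_all _ fun _ ↦ h.norm_le _)

theorem rescale (h : IsBandLimitedKernel φ k) {c l : ℝ} (hc : 0 ≤ c) (hl : 0 < l) :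
    IsBandLimitedKernel (fun t ↦ c * φ (t / l)) (fun y ↦ c * (l * k (l * y))) where
  continuous := by
    have := h.continuous
    fun_prop
  hasCompactSupport := by
    simp only [div_eq_inv_mul]
    exact (h.hasCompactSupport.comp_smul (inv_ne_zero hl.ne')).mul_left
  nonneg y := mul_nonneg hc (mul_nonneg hl.le (h.nonneg _))
  integrable := ((h.integrable.comp_mul_left' hl.ne').const_mul l).const_mul c
  fourier_eq y := by
    have hl' : (l : ℂ) ≠ 0 := by exact_mod_cast hl.ne'
    have hscale := Measure.integral_comp_div
      (fun t : ℝ ↦ (φ t : ℂ) * Complex.exp (Complex.I * t * (l * y : ℝ))) l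
    rw [h.fourier_eq, abs_of_pos hl, Complex.real_smul] at hscale
    rw [Complex.ofReal_mul, Complex.ofReal_mul, ← hscale, ← integral_const_mul]
    refine integral_congr_ae (ae_of_all _ fun t ↦ ?_)
    simp only
    push_cast
    rw [show Complex.I * (t / l) * (l * y) = Complex.I * t * y by field_simp]
    ring

end IsBandLimitedKernel

theorem isBandLimitedKernel_fejer :
    IsBandLimitedKernel (fun t ↦ max 0 (1 - |t|)) (fun y ↦ Real.sinc (y / 2) ^ 2) where
  continuous := by fun_prop
  hasCompactSupport := by
    refine HasCompactSupport.intro (K := Set.Icc (-1) 1) isCompact_Icc fun t ht ↦ ?_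
    have : 1 < |t| := not_le.1 fun h ↦ ht (abs_le.1 h)
    exact max_eq_left (by linarith)
  nonneg y := sq_nonneg _
  integrable := integrable_sinc_sq.comp_div two_ne_zero
  fourier_eq y := by
    rw [← integral_one_sub_abs_mul_cexp,
      ← intervalIntegral.integral_eq_integral_of_support_subset (a := -1) (b := 1)]
    · refine intervalIntegral.integral_congr fun t ht ↦ ?_
      rw [Set.uIcc_of_le (by norm_num)] at ht
      simp only [max_eq_right (sub_nonneg.2 (abs_le.2 ht))]
    · intro t ht
      by_contra hmem
      have : 1 ≤ |t| := by
        by_contra! h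
        exact hmem ⟨(abs_lt.1 h).1, (abs_lt.1 h).2.le⟩
      exact ht (by simp [max_eq_left (sub_nonpos.2 this)])

theorem exists_isBandLimitedKernel_isConcentratedDensity {δ : ℝ} (hδ : 0 < δ) :
    ∃ φ k, IsBandLimitedKernel φ k ∧ IsConcentratedDensity δ k := by
  have hfejer := isBandLimitedKernel_fejer
  set κ : ℝ → ℝ := fun y ↦ Real.sinc (y / 2) ^ 2
  set m := ∫ y, κ y
  have hm : 0 < m := integral_pos_of_integrable_nonneg_nonzero (x := 0) (by fun_prop)
    hfejer.integrable hfejer.nonneg (by simp [κ])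
  have hmass : Tendsto (fun l : ℝ ↦ m⁻¹ * ∫ y in (-(l * δ))..(l * δ), κ y) atTop (𝓝 1) := by
    have hl : Tendsto (fun l : ℝ ↦ l * δ) atTop atTop := tendsto_id.atTop_mul_const hδ
    simpa [m, hm.ne'] using (intervalIntegral_tendsto_integral hfejer.integrable
      (tendsto_neg_atTop_atBot.comp hl) hl).const_mul m⁻¹
  obtain ⟨l, hle, hl⟩ := ((hmass.eventually (eventually_ge_nhds (sub_lt_self 1 hδ))).and
    (eventually_gt_atTop 0)).exists
  have hker := hfejer.rescale (inv_nonneg.2 hm.le) hl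
  refine ⟨_, _, hker, hker.nonneg, hker.integrable, ?_, ?_⟩
  · rw [integral_const_mul, integral_const_mul, Measure.integral_comp_mul_left,
      abs_of_pos (inv_pos.2 hl), smul_eq_mul, mul_inv_cancel_left₀ hl.ne', inv_mul_cancel₀ hm.ne']
  · rw [intervalIntegral.integral_const_mul, intervalIntegral.integral_const_mul,
      intervalIntegral.mul_integral_comp_mul_left]
    simpa using hle

/-! ### The Tauberian theorem for Laplace transforms -/

theorem IsBandLimitedKernel.setIntegral_mul_comp_sub {φ k H : ℝ → ℝ}
    (hk : IsBandLimitedKernel φ k) {ε : ℝ}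
    (hH : IntegrableOn (fun u ↦ H u * Real.exp (-ε * u)) (Set.Ioi 0)) (v : ℝ) :
    ((∫ u in Set.Ioi 0, H u * Real.exp (-ε * u) * k (v - u) : ℝ) : ℂ) =
      ∫ t, φ t * Complex.exp (Complex.I * t * v) *
        ∫ u in Set.Ioi 0, (H u : ℂ) * Complex.exp (-(ε + Complex.I * t) * u) := by
  have hprod : Integrable (Function.uncurry fun u t : ℝ ↦
      (((H u * Real.exp (-ε * u) : ℝ) : ℂ) * (φ t : ℂ)) * Complex.exp (Complex.I * t * (v - u : ℝ)))
      ((volume.restrict (Set.Ioi 0)).prod volume) := by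
    have hmul : Integrable (fun z : ℝ × ℝ ↦ ((H z.1 * Real.exp (-ε * z.1) : ℝ) : ℂ) * (φ z.2 : ℂ))
        ((volume.restrict (Set.Ioi 0)).prod volume) :=
      hH.ofReal.mul_prod hk.integrable_transform.ofReal
    exact hmul.mul_bdd (c := 1) (Continuous.aestronglyMeasurable (by fun_prop))
      (ae_of_all _ fun z ↦ (norm_cexp_I_mul_mul _ _).le)
  calc ((∫ u in Set.Ioi 0, H u * Real.exp (-ε * u) * k (v - u) : ℝ) : ℂ)
    _ = ∫ u in Set.Ioi 0, ((H u * Real.exp (-ε * u) * k (v - u) : ℝ) : ℂ) :=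
      integral_complex_ofReal.symm
    _ = ∫ u in Set.Ioi 0, ∫ t, (((H u * Real.exp (-ε * u) : ℝ) : ℂ) * (φ t : ℂ)) *
        Complex.exp (Complex.I * t * (v - u : ℝ)) := by
      simp_rw [mul_assoc ((H _ * Real.exp _ : ℝ) : ℂ), integral_const_mul, hk.fourier_eq,
        ← Complex.ofReal_mul]
    _ = ∫ t, ∫ u in Set.Ioi 0, (((H u * Real.exp (-ε * u) : ℝ) : ℂ) * (φ t : ℂ)) *
        Complex.exp (Complex.I * t * (v - u : ℝ)) := integral_integral_swap hprod
    _ = _ := by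
      simp_rw [← integral_const_mul]
      refine integral_congr_ae (ae_of_all _ fun t ↦ integral_congr_ae (ae_of_all _ fun u ↦ ?_))
      have hexp : Complex.exp (Complex.I * t * (v - u)) * Complex.exp (-ε * u) =
          Complex.exp (Complex.I * t * v) * Complex.exp (-(ε + Complex.I * t) * u) := by
        rw [← Complex.exp_add, ← Complex.exp_add]
        ring_nf
      push_cast
      linear_combination (H u : ℂ) * φ t * hexp

theorem tendsto_integral_mul_cexp_atTop (f : ℝ → ℂ) :
    Tendsto (fun v : ℝ ↦ ∫ t, f t * Complex.exp (Complex.I * t * v)) atTop (𝓝 0) := by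
  have hfreq : Tendsto (fun v : ℝ ↦ -(v / (2 * Real.pi))) atTop (cocompact ℝ) :=
    (tendsto_neg_atTop_atBot.comp (tendsto_id.atTop_div_const (by positivity))).mono_right
      atBot_le_cocompact
  refine ((Real.tendsto_integral_exp_smul_cocompact f).comp hfreq).congr fun v ↦ ?_
  refine integral_congr_ae (ae_of_all _ fun t ↦ ?_)
  have hpi : (Real.pi : ℂ) ≠ 0 := by exact_mod_cast Real.pi_ne_zero
  simp only [Real.fourierChar_apply, Circle.smul_def, smul_eq_mul]
  rw [mul_comm]
  congr 2
  push_cast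
  field_simp

theorem tendsto_setIntegral_Ioi_comp_sub {k : ℝ → ℝ} (hk : Integrable k) :
    Tendsto (fun v ↦ ∫ u in Set.Ioi 0, k (v - u)) atTop (𝓝 (∫ y, k y)) := by
  have hreflect (v : ℝ) : ∫ u in Set.Ioi 0, k (v - u) = ∫ y in Set.Iio v, k y := by
    rw [← integral_indicator measurableSet_Ioi, ← integral_indicator measurableSet_Iio,
      ← integral_sub_left_eq_self _ volume v]
    simp [Set.indicator_apply]
  simp_rw [hreflect]
  exact (aecover_Iio tendsto_id).integral_tendsto_of_countably_generated hk

theorem setIntegral_cexp_neg_mul {z : ℂ} (hz : 0 < z.re) :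
    ∫ u : ℝ in Set.Ioi 0, Complex.exp (-z * u) = 1 / z := by
  rw [integral_exp_mul_complex_Ioi (by simpa using hz)]
  simp

theorem integrableOn_ofReal_mul_cexp {f : ℝ → ℝ} {s : Set ℝ} {z : ℂ}
    (hf : IntegrableOn (fun u ↦ f u * Real.exp (-z.re * u)) s) :
    IntegrableOn (fun u : ℝ ↦ (f u : ℂ) * Complex.exp (-z * u)) s := by
  have hosc : Integrable (fun u : ℝ ↦ ((f u * Real.exp (-z.re * u) : ℝ) : ℂ) *
      Complex.exp (Complex.I * u * (-z.im : ℝ))) (volume.restrict s) :=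
    hf.ofReal.mul_bdd (c := 1) (Continuous.aestronglyMeasurable (by fun_prop))
      (ae_of_all _ fun u ↦ (norm_cexp_I_mul_mul _ _).le)
  refine hosc.congr (ae_of_all _ fun u ↦ ?_)
  have hexp : Complex.exp (-z.re * u) * Complex.exp (Complex.I * u * -z.im) =
      Complex.exp (-z * u) := by
    rw [← Complex.exp_add]
    congr 1
    linear_combination (-(u : ℂ)) * z.re_add_im
  push_cast
  rw [mul_assoc, hexp]

theorem tendsto_setIntegral_mul_exp_neg_mul {F : ℝ → ℝ} (hF : IntegrableOn F (Set.Ioi 0)) :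
    Tendsto (fun ε : ℝ ↦ ∫ u in Set.Ioi 0, F u * Real.exp (-ε * u)) (𝓝[>] 0)
      (𝓝 (∫ u in Set.Ioi 0, F u)) := by
  refine tendsto_integral_filter_of_dominated_convergence (fun u ↦ ‖F u‖)
    (Eventually.of_forall fun ε ↦ hF.aestronglyMeasurable.mul
      (Continuous.aestronglyMeasurable (by fun_prop))) ?_ hF.norm (ae_of_all _ fun u ↦ ?_)
  · filter_upwards [self_mem_nhdsWithin] with ε (hε : 0 < ε)
    filter_upwards [ae_restrict_mem measurableSet_Ioi] with u (hu : 0 < u)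
    rw [norm_mul, Real.norm_of_nonneg (Real.exp_nonneg _)]
    exact mul_le_of_le_one_right (norm_nonneg _) (Real.exp_le_one_iff.2 (by nlinarith))
  · have hcont : Continuous fun ε : ℝ ↦ F u * Real.exp (-ε * u) := by fun_prop
    simpa using (hcont.tendsto 0).mono_left nhdsWithin_le_nhds

theorem integrableOn_of_tendsto_mul_exp_neg_mul {F : ℝ → ℝ} {L : ℝ} (hF : ∀ u, 0 ≤ F u)
    (hint : ∀ ε > 0, IntegrableOn (fun u ↦ F u * Real.exp (-ε * u)) (Set.Ioi 0))
    (hL : Tendsto (fun ε : ℝ ↦ ∫ u in Set.Ioi 0, F u * Real.exp (-ε * u)) (𝓝[>] 0) (𝓝 L)) :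
    IntegrableOn F (Set.Ioi 0) := by
  obtain ⟨e, -, he, htends⟩ := exists_seq_strictAnti_tendsto (0 : ℝ)
  have hlim := hL.comp (tendsto_nhdsWithin_iff.2 ⟨htends, Eventually.of_forall he⟩)
  refine integrable_of_tendsto (G := fun n u ↦ F u * Real.exp (-e n * u)) (ae_of_all _ fun u ↦ ?_)
    (fun n ↦ (hint _ (he n)).aestronglyMeasurable) ?_
  · have hcont : Continuous fun ε : ℝ ↦ F u * Real.exp (-ε * u) := by fun_prop
    simpa [Function.comp_def] using (hcont.tendsto 0).comp htends
  · have henorm (n : ℕ) : ∫⁻ u in Set.Ioi 0, ‖F u * Real.exp (-e n * u)‖ₑ =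
        ENNReal.ofReal (∫ u in Set.Ioi 0, F u * Real.exp (-e n * u)) := by
      rw [← ofReal_integral_norm_eq_lintegral_enorm (hint _ (he n))]
      simp only [Real.norm_of_nonneg (mul_nonneg (hF _) (Real.exp_nonneg _))]
    simp_rw [henorm]
    exact (ENNReal.tendsto_ofReal hlim).liminf_eq.trans_ne ENNReal.ofReal_ne_top

/-- The function `S` on the positive half-line has a Laplace transform on `re z > 0`, of the form
`A / z + g z` with `g` continuous up to the imaginary axis. -/
structure HasLaplaceBoundary (S : ℝ → ℝ) (A : ℝ) (g : ℂ → ℂ) : Prop where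
  integrableOn : ∀ ε > 0, IntegrableOn (fun u ↦ S u * Real.exp (-ε * u)) (Set.Ioi 0)
  continuousOn : ContinuousOn g {z | 0 ≤ z.re}
  laplace_eq : ∀ z : ℂ, 0 < z.re →
    ∫ u in Set.Ioi 0, (S u : ℂ) * Complex.exp (-z * u) = A / z + g z

namespace HasLaplaceBoundary

variable {S φ k : ℝ → ℝ} {A : ℝ} {g : ℂ → ℂ}

theorem integrableOn_sub (hS : HasLaplaceBoundary S A g) {ε : ℝ} (hε : 0 < ε) :
    IntegrableOn (fun u ↦ (S u - A) * Real.exp (-ε * u)) (Set.Ioi 0) := by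
  simp_rw [sub_mul]
  exact (hS.integrableOn ε hε).sub ((exp_neg_integrableOn_Ioi 0 hε).const_mul A)

theorem laplace_sub_eq (hS : HasLaplaceBoundary S A g) {z : ℂ} (hz : 0 < z.re) :
    ∫ u in Set.Ioi 0, ((S u - A : ℝ) : ℂ) * Complex.exp (-z * u) = g z := by
  simp_rw [Complex.ofReal_sub, sub_mul]
  rw [integral_sub (integrableOn_ofReal_mul_cexp (hS.integrableOn _ hz))
    (integrableOn_ofReal_mul_cexp ((exp_neg_integrableOn_Ioi 0 hz).const_mul A)),
    hS.laplace_eq z hz, integral_const_mul, setIntegral_cexp_neg_mul hz]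
  ring

theorem setIntegral_mul_comp_sub (hS : HasLaplaceBoundary S A g) (hk : IsBandLimitedKernel φ k)
    {ε : ℝ} (hε : 0 < ε) (v : ℝ) :
    ∫ u in Set.Ioi 0, S u * k (v - u) * Real.exp (-ε * u) =
      A * (∫ u in Set.Ioi 0, k (v - u) * Real.exp (-ε * u)) +
        (∫ t, φ t * Complex.exp (Complex.I * t * v) * g (ε + Complex.I * t)).re := by
  have hfourier := hk.setIntegral_mul_comp_sub (hS.integrableOn_sub hε) v
  have hlap (t : ℝ) := hS.laplace_sub_eq (z := ε + Complex.I * t) (by simpa using hε)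
  simp_rw [hlap] at hfourier
  rw [← hfourier, Complex.ofReal_re, ← integral_const_mul, ← integral_add]
  · exact integral_congr_ae (ae_of_all _ fun u ↦ by ring)
  · have h := hk.integrableOn_mul_comp_sub ((exp_neg_integrableOn_Ioi 0 hε).const_mul A) v
    exact h.congr (ae_of_all _ fun u ↦ by ring)
  · exact hk.integrableOn_mul_comp_sub (hS.integrableOn_sub hε) v

end HasLaplaceBoundary

theorem tendsto_integral_mul_boundary {ψ : ℝ → ℂ} {g : ℂ → ℂ} (hψ : Continuous ψ)
    (hψs : HasCompactSupport ψ) (hg : ContinuousOn g {z | 0 ≤ z.re}) :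
    Tendsto (fun ε : ℝ ↦ ∫ t, ψ t * g (ε + Complex.I * t)) (𝓝[>] 0)
      (𝓝 (∫ t : ℝ, ψ t * g (Complex.I * t))) := by
  have hcompact : IsCompact ((fun p : ℝ × ℝ ↦ (p.1 : ℂ) + Complex.I * p.2) ''
      (Set.Icc 0 1 ×ˢ tsupport ψ)) := (isCompact_Icc.prod hψs).image (by fun_prop)
  obtain ⟨C, hC⟩ := hcompact.exists_bound_of_continuousOn (f := g) (hg.mono (by
    rintro _ ⟨p, hp, rfl⟩
    simpa using hp.1.1))
  refine tendsto_integral_filter_of_dominated_convergence (fun t ↦ ‖ψ t‖ * C) ?_ ?_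
    ((hψ.integrable_of_hasCompactSupport hψs).norm.mul_const C) (ae_of_all _ fun t ↦ ?_)
  · filter_upwards [self_mem_nhdsWithin] with ε (hε : 0 < ε)
    have hgε : Continuous fun t : ℝ ↦ g (ε + Complex.I * t) :=
      hg.comp_continuous (by fun_prop) fun t ↦ by simpa using hε.le
    exact (hψ.mul hgε).aestronglyMeasurable
  · filter_upwards [Ioc_mem_nhdsGT one_pos] with ε hε
    refine ae_of_all _ fun t ↦ ?_
    rw [norm_mul]
    by_cases ht : t ∈ tsupport ψ
    · exact mul_le_mul_of_nonneg_left (hC _ ⟨(ε, t), ⟨⟨hε.1.le, hε.2⟩, ht⟩, rfl⟩) (norm_nonneg _)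
    · simp [image_eq_zero_of_notMem_tsupport ht]
  · refine Tendsto.const_mul _ ((hg (Complex.I * t) (by simp)).tendsto.comp
      (tendsto_nhdsWithin_iff.2 ⟨?_, ?_⟩))
    · have hcont : Continuous fun ε : ℝ ↦ (ε : ℂ) + Complex.I * t := by fun_prop
      simpa using (hcont.tendsto 0).mono_left nhdsWithin_le_nhds
    · filter_upwards [self_mem_nhdsWithin] with ε (hε : 0 < ε)
      simpa using hε.le

namespace HasLaplaceBoundary

variable {S φ k : ℝ → ℝ} {A : ℝ} {g : ℂ → ℂ}

theorem tendsto_setIntegral_kernel_mul_exp (hS : HasLaplaceBoundary S A g)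
    (hk : IsBandLimitedKernel φ k) (v : ℝ) :
    Tendsto (fun ε : ℝ ↦ ∫ u in Set.Ioi 0, S u * k (v - u) * Real.exp (-ε * u)) (𝓝[>] 0)
      (𝓝 (A * (∫ u in Set.Ioi 0, k (v - u)) +
        (∫ t : ℝ, φ t * Complex.exp (Complex.I * t * v) * g (Complex.I * t)).re)) := by
  have hψ : Continuous fun t : ℝ ↦ (φ t : ℂ) * Complex.exp (Complex.I * t * v) := by
    have := hk.continuous
    fun_prop
  have hψs : HasCompactSupport fun t : ℝ ↦ (φ t : ℂ) * Complex.exp (Complex.I * t * v) :=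
    (hk.hasCompactSupport.comp_left Complex.ofReal_zero).mul_right
  have hmain := tendsto_setIntegral_mul_exp_neg_mul
    (hk.integrable.comp_sub_left v).integrableOn
  refine ((hmain.const_mul A).add ((Complex.continuous_re.tendsto _).comp
    (tendsto_integral_mul_boundary hψ hψs hS.continuousOn))).congr' ?_
  filter_upwards [self_mem_nhdsWithin] with ε hε
  exact (hS.setIntegral_mul_comp_sub hk hε v).symm

theorem integrableOn_mul_kernel (hS : HasLaplaceBoundary S A g) (hS0 : ∀ u, 0 ≤ S u)
    (hk : IsBandLimitedKernel φ k) (v : ℝ) :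
    IntegrableOn (fun u ↦ S u * k (v - u)) (Set.Ioi 0) := by
  refine integrableOn_of_tendsto_mul_exp_neg_mul (fun u ↦ mul_nonneg (hS0 u) (hk.nonneg _))
    (fun ε hε ↦ ?_) (hS.tendsto_setIntegral_kernel_mul_exp hk v)
  exact (hk.integrableOn_mul_comp_sub (hS.integrableOn ε hε) v).congr
    (ae_of_all _ fun u ↦ mul_right_comm _ _ _)

theorem tendsto_setIntegral_mul_kernel (hS : HasLaplaceBoundary S A g) (hS0 : ∀ u, 0 ≤ S u)
    (hk : IsBandLimitedKernel φ k) :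
    Tendsto (fun v ↦ ∫ u in Set.Ioi 0, S u * k (v - u)) atTop (𝓝 (A * ∫ y, k y)) := by
  have heq (v : ℝ) : ∫ u in Set.Ioi 0, S u * k (v - u) = A * (∫ u in Set.Ioi 0, k (v - u)) +
      (∫ t : ℝ, φ t * g (Complex.I * t) * Complex.exp (Complex.I * t * v)).re := by
    simp_rw [mul_right_comm _ (g _)]
    exact tendsto_nhds_unique (tendsto_setIntegral_mul_exp_neg_mul
      (hS.integrableOn_mul_kernel hS0 hk v)) (hS.tendsto_setIntegral_kernel_mul_exp hk v)
  simp_rw [heq]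
  simpa using ((tendsto_setIntegral_Ioi_comp_sub hk.integrable).const_mul A).add
    ((Complex.continuous_re.tendsto _).comp (tendsto_integral_mul_cexp_atTop _))

end HasLaplaceBoundary

namespace IsConcentratedDensity

variable {δ : ℝ} {k : ℝ → ℝ}

theorem one_sub_le_setIntegral (h : IsConcentratedDensity δ k) (hδ : 0 ≤ δ) (w : ℝ) :
    1 - δ ≤ ∫ u in Set.Icc (w - δ) (w + δ), k (w - u) := by
  rw [integral_Icc_eq_integral_Ioc, ← intervalIntegral.integral_of_le (by linarith),
    intervalIntegral.integral_comp_sub_left]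
  simpa using h.one_sub_le

theorem setIntegral_compl_le (h : IsConcentratedDensity δ k) (hδ : 0 ≤ δ) (w : ℝ) :
    ∫ u in (Set.Icc (w - δ) (w + δ))ᶜ, k (w - u) ≤ δ := by
  have hsplit := integral_add_compl (measurableSet_Icc (a := w - δ) (b := w + δ))
    (h.integrable.comp_sub_left w)
  rw [integral_sub_left_eq_self k volume w, h.integral_eq_one] at hsplit
  linarith [h.one_sub_le_setIntegral hδ w]

variable {S : ℝ → ℝ}

theorem mul_le_setIntegral (h : IsConcentratedDensity δ k) (hδ : 0 ≤ δ)
    (hS : ∀ u, 0 ≤ S u) (hdecr : ∀ u v, u ≤ v → S u ≤ Real.exp (v - u) * S v) {v : ℝ} (hv : 0 < v)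
    (hint : IntegrableOn (fun u ↦ S u * k (v + δ - u)) (Set.Ioi 0)) :
    Real.exp (-(2 * δ)) * S v * (1 - δ) ≤ ∫ u in Set.Ioi 0, S u * k (v + δ - u) := by
  set I := Set.Icc (v + δ - δ) (v + δ + δ)
  have hI : I ⊆ Set.Ioi 0 := fun u hu ↦ by
    have := hu.1
    simp only [Set.mem_Ioi]
    linarith
  calc Real.exp (-(2 * δ)) * S v * (1 - δ)
    _ ≤ Real.exp (-(2 * δ)) * S v * ∫ u in I, k (v + δ - u) :=
      mul_le_mul_of_nonneg_left (h.one_sub_le_setIntegral hδ _)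
        (mul_nonneg (Real.exp_nonneg _) (hS v))
    _ = ∫ u in I, Real.exp (-(2 * δ)) * S v * k (v + δ - u) := (integral_const_mul _ _).symm
    _ ≤ ∫ u in I, S u * k (v + δ - u) := by
      refine setIntegral_mono_on ((h.integrable.comp_sub_left _).integrableOn.const_mul _)
        (hint.mono_set hI) measurableSet_Icc fun u hu ↦
          mul_le_mul_of_nonneg_right ?_ (h.nonneg _)
      rw [Real.exp_neg, inv_mul_le_iff₀ (Real.exp_pos _)]
      refine (hdecr v u (by linarith [hu.1])).trans ?_
      exact mul_le_mul_of_nonneg_right (Real.exp_le_exp.2 (by linarith [hu.2])) (hS u)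
    _ ≤ ∫ u in Set.Ioi 0, S u * k (v + δ - u) :=
      setIntegral_mono_set hint (ae_of_all _ fun u ↦ mul_nonneg (hS u) (h.nonneg _)) hI.eventuallyLE

theorem setIntegral_near_le (h : IsConcentratedDensity δ k) (hS : ∀ u, 0 ≤ S u)
    (hdecr : ∀ u v, u ≤ v → S u ≤ Real.exp (v - u) * S v) (v : ℝ)
    (hint : IntegrableOn (fun u ↦ S u * k (v - δ - u)) (Set.Ioi 0)) :
    ∫ u in Set.Ioi 0 ∩ Set.Icc (v - δ - δ) (v - δ + δ), S u * k (v - δ - u) ≤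
      Real.exp (2 * δ) * S v := by
  set I := Set.Icc (v - δ - δ) (v - δ + δ)
  have hkint : Integrable fun u ↦ k (v - δ - u) := h.integrable.comp_sub_left _
  calc ∫ u in Set.Ioi 0 ∩ I, S u * k (v - δ - u)
    _ ≤ ∫ u in Set.Ioi 0 ∩ I, Real.exp (2 * δ) * S v * k (v - δ - u) := by
      refine setIntegral_mono_on (hint.mono_set Set.inter_subset_left)
        (hkint.integrableOn.const_mul _) (measurableSet_Ioi.inter measurableSet_Icc)
        fun u hu ↦ mul_le_mul_of_nonneg_right ?_ (h.nonneg _)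
      refine (hdecr u v (by linarith [hu.2.2])).trans ?_
      exact mul_le_mul_of_nonneg_right (Real.exp_le_exp.2 (by linarith [hu.2.1])) (hS v)
    _ = Real.exp (2 * δ) * S v * ∫ u in Set.Ioi 0 ∩ I, k (v - δ - u) := integral_const_mul _ _
    _ ≤ Real.exp (2 * δ) * S v * ∫ u, k (v - δ - u) :=
      mul_le_mul_of_nonneg_left (setIntegral_le_integral hkint (ae_of_all _ fun _ ↦ h.nonneg _))
        (mul_nonneg (Real.exp_nonneg _) (hS v))
    _ = Real.exp (2 * δ) * S v := by
      rw [integral_sub_left_eq_self, h.integral_eq_one, mul_one]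

theorem setIntegral_far_le (h : IsConcentratedDensity δ k) (hδ : 0 ≤ δ) (hS : ∀ u, 0 ≤ S u)
    {M : ℝ} (hM : ∀ u > 0, S u ≤ M) (v : ℝ)
    (hint : IntegrableOn (fun u ↦ S u * k (v - u)) (Set.Ioi 0)) :
    ∫ u in Set.Ioi 0 \ Set.Icc (v - δ) (v + δ), S u * k (v - u) ≤ M * δ := by
  set I := Set.Icc (v - δ) (v + δ)
  have hkint : Integrable fun u ↦ k (v - u) := h.integrable.comp_sub_left _
  have hM0 : 0 ≤ M := (hS 1).trans (hM 1 one_pos)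
  calc ∫ u in Set.Ioi 0 \ I, S u * k (v - u)
    _ ≤ ∫ u in Set.Ioi 0 \ I, M * k (v - u) :=
      setIntegral_mono_on (hint.mono_set Set.sdiff_subset) (hkint.integrableOn.const_mul _)
        (measurableSet_Ioi.diff measurableSet_Icc)
        fun u hu ↦ mul_le_mul_of_nonneg_right (hM u hu.1) (h.nonneg _)
    _ = M * ∫ u in Set.Ioi 0 \ I, k (v - u) := integral_const_mul _ _
    _ ≤ M * ∫ u in Iᶜ, k (v - u) :=
      mul_le_mul_of_nonneg_left (setIntegral_mono_set hkint.integrableOn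
        (ae_of_all _ fun _ ↦ h.nonneg _) (Set.sdiff_subset_compl _ _).eventuallyLE) hM0
    _ ≤ M * δ := mul_le_mul_of_nonneg_left (h.setIntegral_compl_le hδ _) hM0

theorem setIntegral_le (h : IsConcentratedDensity δ k) (hδ : 0 ≤ δ)
    (hS : ∀ u, 0 ≤ S u) (hdecr : ∀ u v, u ≤ v → S u ≤ Real.exp (v - u) * S v) {M : ℝ}
    (hM : ∀ u > 0, S u ≤ M) (v : ℝ)
    (hint : IntegrableOn (fun u ↦ S u * k (v - δ - u)) (Set.Ioi 0)) :
    ∫ u in Set.Ioi 0, S u * k (v - δ - u) ≤ Real.exp (2 * δ) * S v + M * δ := by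
  rw [← integral_inter_add_sdiff (measurableSet_Icc (a := v - δ - δ) (b := v - δ + δ)) hint]
  exact add_le_add (h.setIntegral_near_le hS hdecr v hint)
    (h.setIntegral_far_le hδ hS hM (v - δ) hint)

end IsConcentratedDensity

/-- Average values of `S` against arbitrarily concentrated densities tend to `A`. -/
def HasAverageLimit (S : ℝ → ℝ) (A : ℝ) : Prop :=
  ∀ δ > 0, ∃ k, IsConcentratedDensity δ k ∧
    (∀ v, IntegrableOn (fun u ↦ S u * k (v - u)) (Set.Ioi 0)) ∧
    Tendsto (fun v ↦ ∫ u in Set.Ioi 0, S u * k (v - u)) atTop (𝓝 A)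

theorem HasLaplaceBoundary.hasAverageLimit {S : ℝ → ℝ} {A : ℝ} {g : ℂ → ℂ}
    (h : HasLaplaceBoundary S A g) (hS : ∀ u, 0 ≤ S u) : HasAverageLimit S A := by
  intro δ hδ
  obtain ⟨φ, k, hφ, hk⟩ := exists_isBandLimitedKernel_isConcentratedDensity hδ
  refine ⟨k, hk, h.integrableOn_mul_kernel hS hφ, ?_⟩
  simpa [hk.integral_eq_one] using h.tendsto_setIntegral_mul_kernel hS hφ

namespace HasAverageLimit

variable {S : ℝ → ℝ} {A : ℝ}

theorem eventually_le (h : HasAverageLimit S A) (hS : ∀ u, 0 ≤ S u)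
    (hdecr : ∀ u v, u ≤ v → S u ≤ Real.exp (v - u) * S v) {δ : ℝ} (hδ : δ ∈ Set.Ioo (0 : ℝ) 1) :
    ∀ᶠ v in atTop, S v ≤ Real.exp (2 * δ) * (A + δ) / (1 - δ) := by
  obtain ⟨k, hk, hint, hlim⟩ := h δ hδ.1
  have hlim' := hlim.comp (tendsto_atTop_add_const_right _ δ tendsto_id)
  filter_upwards [hlim'.eventually (eventually_le_nhds (lt_add_of_pos_right A hδ.1)),
    eventually_gt_atTop 0] with v hle hv
  have hmain := (hk.mul_le_setIntegral hδ.1.le hS hdecr hv (hint _)).trans hle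
  rw [mul_assoc, Real.exp_neg, inv_mul_le_iff₀ (Real.exp_pos _)] at hmain
  rwa [le_div_iff₀ (by linarith [hδ.2])]

theorem exists_bound (h : HasAverageLimit S A) (hS : ∀ u, 0 ≤ S u)
    (hdecr : ∀ u v, u ≤ v → S u ≤ Real.exp (v - u) * S v) : ∃ M, ∀ u > 0, S u ≤ M := by
  obtain ⟨v₀, hv₀⟩ := eventually_atTop.1
    (h.eventually_le hS hdecr (δ := 1 / 2) ⟨by norm_num, by norm_num⟩)
  set C := Real.exp (2 * (1 / 2)) * (A + 1 / 2) / (1 - 1 / 2)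
  have hC : 0 ≤ C := (hS _).trans (hv₀ v₀ le_rfl)
  refine ⟨Real.exp |v₀| * C, fun u hu ↦ ?_⟩
  rcases le_total v₀ u with hle | hle
  · exact (hv₀ u hle).trans (le_mul_of_one_le_left hC (Real.one_le_exp (abs_nonneg _)))
  · exact (hdecr u v₀ hle).trans (mul_le_mul
      (Real.exp_le_exp.2 (by linarith [le_abs_self v₀])) (hv₀ _ le_rfl) (hS _) (Real.exp_nonneg _))

theorem eventually_ge (h : HasAverageLimit S A) (hS : ∀ u, 0 ≤ S u)
    (hdecr : ∀ u v, u ≤ v → S u ≤ Real.exp (v - u) * S v) {M : ℝ} (hM : ∀ u > 0, S u ≤ M)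
    {δ : ℝ} (hδ : 0 < δ) : ∀ᶠ v in atTop, Real.exp (-(2 * δ)) * (A - δ - M * δ) ≤ S v := by
  obtain ⟨k, hk, hint, hlim⟩ := h δ hδ
  have hlim' := hlim.comp (tendsto_atTop_add_const_right _ (-δ) tendsto_id)
  filter_upwards [hlim'.eventually (eventually_ge_nhds (sub_lt_self A hδ))] with v hle
  have hmain := hle.trans (hk.setIntegral_le hδ.le hS hdecr hM v (hint _))
  rw [Real.exp_neg, inv_mul_le_iff₀ (Real.exp_pos _)]
  linarith

theorem tendsto (h : HasAverageLimit S A) (hS : ∀ u, 0 ≤ S u)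
    (hdecr : ∀ u v, u ≤ v → S u ≤ Real.exp (v - u) * S v) : Tendsto S atTop (𝓝 A) := by
  obtain ⟨M, hM⟩ := h.exists_bound hS hdecr
  have hsmall : ∀ᶠ δ : ℝ in 𝓝[>] 0, δ ∈ Set.Ioo (0 : ℝ) 1 := Ioo_mem_nhdsGT one_pos
  have hlower : Tendsto (fun δ ↦ Real.exp (-(2 * δ)) * (A - δ - M * δ)) (𝓝[>] 0) (𝓝 A) := by
    have hcont : ContinuousAt (fun δ ↦ Real.exp (-(2 * δ)) * (A - δ - M * δ)) 0 := by fun_prop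
    simpa using hcont.tendsto.mono_left nhdsWithin_le_nhds
  have hupper : Tendsto (fun δ ↦ Real.exp (2 * δ) * (A + δ) / (1 - δ)) (𝓝[>] 0) (𝓝 A) := by
    have hcont : ContinuousAt (fun δ ↦ Real.exp (2 * δ) * (A + δ) / (1 - δ)) 0 :=
      ContinuousAt.div (by fun_prop) (by fun_prop) (by norm_num)
    simpa using hcont.tendsto.mono_left nhdsWithin_le_nhds
  refine tendsto_order.2 ⟨fun a ha ↦ ?_, fun a ha ↦ ?_⟩
  · obtain ⟨δ, hlt, hδ⟩ := ((hlower.eventually (eventually_gt_nhds ha)).and hsmall).exists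
    exact (h.eventually_ge hS hdecr hM hδ.1).mono fun v ↦ hlt.trans_le
  · obtain ⟨δ, hlt, hδ⟩ := ((hupper.eventually (eventually_lt_nhds ha)).and hsmall).exists
    exact (h.eventually_le hS hdecr hδ).mono fun v hv ↦ hv.trans_lt hlt

end HasAverageLimit

/-! ### Dirichlet series and the Wiener–Ikehara theorem -/

/-- The general Dirichlet series `∑ aᵢ exp (-s uᵢ)` with coefficients `a` and frequencies `u`. -/
noncomputable def dirichletSum {ι : Type*} (a : ι → ℂ) (u : ι → ℝ) (s : ℂ) : ℂ :=
  ∑' i, a i * Complex.exp (-s * u i)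

/-- The summatory function of the coefficients `a` of a general Dirichlet series with
frequencies `u`. -/
noncomputable def summatory {ι E : Type*} [AddCommMonoid E] [TopologicalSpace E] (a : ι → E)
    (u : ι → ℝ) (v : ℝ) : E :=
  ∑' i, if u i ≤ v then a i else 0

/-- A general Dirichlet series with nonnegative frequencies that converges absolutely on
`re s > 1`. -/
structure DirichletSummable {ι E : Type*} [Norm E] (a : ι → E) (u : ι → ℝ) : Prop where
  freq_nonneg : ∀ i, 0 ≤ u i
  summable : ∀ σ : ℝ, 1 < σ → Summable fun i ↦ ‖a i‖ * Real.exp (-σ * u i)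

theorem isOpen_lt_re (σ : ℝ) : IsOpen {s : ℂ | σ < s.re} :=
  isOpen_lt continuous_const Complex.continuous_re

theorem norm_mul_cexp_neg_mul (c s : ℂ) (x : ℝ) :
    ‖c * Complex.exp (-s * x)‖ = ‖c‖ * Real.exp (-s.re * x) := by
  rw [norm_mul, Complex.norm_exp]
  simp

namespace DirichletSummable

variable {ι E E' : Type*} {u : ι → ℝ}

theorem of_norm_le [SeminormedAddCommGroup E] [Norm E'] {a : ι → E} {b : ι → E'}
    (hb : DirichletSummable b u) {C : ℝ} (hab : ∀ i, ‖a i‖ ≤ C * ‖b i‖) :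
    DirichletSummable a u where
  freq_nonneg := hb.freq_nonneg
  summable σ hσ := by
    refine ((hb.summable σ hσ).mul_left C).of_nonneg_of_le
      (fun i ↦ mul_nonneg (norm_nonneg _) (Real.exp_nonneg _)) fun i ↦ ?_
    rw [← mul_assoc]
    exact mul_le_mul_of_nonneg_right (hab i) (Real.exp_nonneg _)

theorem freq_mul {a : ι → ℂ} (ha : DirichletSummable a u) :
    DirichletSummable (fun i ↦ u i * a i) u where
  freq_nonneg := ha.freq_nonneg
  summable σ hσ := by
    set τ := (σ - 1) / 2
    have hτ : 0 < τ := div_pos (sub_pos.2 hσ) two_pos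
    refine ((ha.summable (σ - τ) (by simp only [τ]; linarith)).mul_left τ⁻¹).of_nonneg_of_le
      (fun i ↦ mul_nonneg (norm_nonneg _) (Real.exp_nonneg _)) fun i ↦ ?_
    have hu : u i ≤ τ⁻¹ * Real.exp (τ * u i) := by
      rw [le_inv_mul_iff₀ hτ]
      linarith [Real.add_one_le_exp (τ * u i)]
    have hexp : Real.exp (-(σ - τ) * u i) = Real.exp (τ * u i) * Real.exp (-σ * u i) := by
      rw [← Real.exp_add]
      ring_nf
    rw [norm_mul, Complex.norm_real, Real.norm_of_nonneg (ha.freq_nonneg i), hexp]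
    calc u i * ‖a i‖ * Real.exp (-σ * u i)
      _ ≤ τ⁻¹ * Real.exp (τ * u i) * ‖a i‖ * Real.exp (-σ * u i) := by gcongr
      _ = τ⁻¹ * (‖a i‖ * (Real.exp (τ * u i) * Real.exp (-σ * u i))) := by ring

theorem summable_norm {a : ι → ℂ} (ha : DirichletSummable a u) {s : ℂ} (hs : 1 < s.re) :
    Summable fun i ↦ ‖a i * Complex.exp (-s * u i)‖ := by
  simpa only [norm_mul_cexp_neg_mul] using ha.summable s.re hs

theorem hasSum {a : ι → ℂ} (ha : DirichletSummable a u) {s : ℂ} (hs : 1 < s.re) :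
    HasSum (fun i ↦ a i * Complex.exp (-s * u i)) (dirichletSum a u s) :=
  (ha.summable_norm hs).of_norm.hasSum

theorem hasDerivAt {a : ι → ℂ} (ha : DirichletSummable a u) {s : ℂ} (hs : 1 < s.re) :
    HasDerivAt (dirichletSum a u) (-dirichletSum (fun i ↦ u i * a i) u s) s := by
  obtain ⟨σ, hσ, hσs⟩ := exists_between hs
  have hder (i : ι) (z : ℂ) : HasDerivAt (fun z ↦ a i * Complex.exp (-z * u i))
      (-(u i * a i * Complex.exp (-z * u i))) z := by
    refine (((hasDerivAt_id' z).fun_neg.mul_const (u i : ℂ)).cexp.const_mul (a i)).congr_deriv ?_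
    ring
  have h := hasDerivAt_tsum_of_isPreconnected (ha.freq_mul.summable σ hσ) (isOpen_lt_re σ)
    (convex_halfSpace_re_gt σ).isPreconnected (fun i z _ ↦ hder i z) (fun i z (hz : σ < z.re) ↦ ?_)
    hσs (ha.hasSum hs).summable hσs
  · rwa [tsum_neg] at h
  · rw [norm_neg, norm_mul_cexp_neg_mul]
    have := mul_le_mul_of_nonneg_right hz.le (ha.freq_nonneg i)
    exact mul_le_mul_of_nonneg_left (Real.exp_le_exp.2 (by linarith)) (norm_nonneg _)

theorem norm_ite_le [NormedAddCommGroup E] (a : ι → E) {σ : ℝ} (hσ : 0 ≤ σ) (v : ℝ) (i : ι) :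
    ‖if u i ≤ v then a i else 0‖ ≤ ‖a i‖ * Real.exp (-σ * u i) * Real.exp (σ * v) := by
  split_ifs with h
  · rw [mul_assoc, ← Real.exp_add]
    exact le_mul_of_one_le_right (norm_nonneg _) (Real.one_le_exp (by nlinarith))
  · rw [norm_zero]
    positivity

theorem summable_ite [NormedAddCommGroup E] [CompleteSpace E] {a : ι → E}
    (ha : DirichletSummable a u) (v : ℝ) : Summable fun i ↦ if u i ≤ v then a i else 0 :=
  ((ha.summable 2 one_lt_two).mul_right (Real.exp (2 * v))).of_norm_bounded
    (norm_ite_le a two_pos.le v)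

theorem norm_summatory_le [NormedAddCommGroup E] {a : ι → E} (ha : DirichletSummable a u) {σ : ℝ}
    (hσ : 1 < σ) (v : ℝ) :
    ‖summatory a u v‖ ≤ (∑' i, ‖a i‖ * Real.exp (-σ * u i)) * Real.exp (σ * v) :=
  tsum_of_norm_bounded ((ha.summable σ hσ).hasSum.mul_right _) (norm_ite_le a (by linarith) v)

theorem monotone_summatory {a : ι → ℝ} (ha : DirichletSummable a u) (ha0 : ∀ i, 0 ≤ a i) :
    Monotone (summatory a u) := by
  intro v w hvw
  refine (ha.summable_ite v).tsum_le_tsum (fun i ↦ ?_) (ha.summable_ite w)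
  split_ifs with hv hw hw
  exacts [le_rfl, absurd (hv.trans hvw) hw, ha0 i, le_rfl]

theorem integrableOn_exp_neg_mul_summatory {a : ι → ℝ} (ha : DirichletSummable a u)
    (ha0 : ∀ i, 0 ≤ a i) {ε : ℝ} (hε : 0 < ε) :
    IntegrableOn (fun t ↦ Real.exp (-t) * summatory a u t * Real.exp (-ε * t)) (Set.Ioi 0) := by
  set C := ∑' i, ‖a i‖ * Real.exp (-(1 + ε / 2) * u i)
  refine ((exp_neg_integrableOn_Ioi 0 (half_pos hε)).const_mul C).mono' ?_
    (ae_of_all _ fun t ↦ ?_)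
  · have := (ha.monotone_summatory ha0).measurable
    exact Measurable.aestronglyMeasurable (by fun_prop)
  · rw [norm_mul, norm_mul, Real.norm_of_nonneg (Real.exp_nonneg _),
      Real.norm_of_nonneg (Real.exp_nonneg _)]
    calc Real.exp (-t) * ‖summatory a u t‖ * Real.exp (-ε * t)
      _ ≤ Real.exp (-t) * (C * Real.exp ((1 + ε / 2) * t)) * Real.exp (-ε * t) := by
        gcongr
        exact ha.norm_summatory_le (by linarith) t
      _ = C * (Real.exp (-t) * Real.exp ((1 + ε / 2) * t) * Real.exp (-ε * t)) := by ring
      _ = C * Real.exp (-(ε / 2) * t) := by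
        rw [← Real.exp_add, ← Real.exp_add]
        ring_nf

theorem integrableOn_ite_mul_cexp (c : ℂ) (x : ℝ) {w : ℂ} (hw : 0 < w.re) :
    IntegrableOn (fun t : ℝ ↦ (if x ≤ t then c else 0) * Complex.exp (-w * t)) (Set.Ioi 0) := by
  refine Integrable.bdd_mul (c := ‖c‖)
    (integrableOn_exp_mul_complex_Ioi (a := -w) (by simpa using hw) 0)
    (Measurable.ite measurableSet_Ici measurable_const measurable_const).aestronglyMeasurable
    (ae_of_all _ fun t ↦ ?_)
  split_ifs <;> simp

theorem setIntegral_ite_mul_cexp (c : ℂ) {x : ℝ} (hx : 0 ≤ x) {w : ℂ} (hw : 0 < w.re) :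
    ∫ t : ℝ in Set.Ioi 0, (if x ≤ t then c else 0) * Complex.exp (-w * t) =
      c * Complex.exp (-w * x) / w := by
  have hind (t : ℝ) : (if x ≤ t then c else 0) * Complex.exp (-w * t) =
      (Set.Ici x).indicator (fun t : ℝ ↦ c * Complex.exp (-w * t)) t := by
    simp [Set.indicator_apply]
  simp_rw [hind]
  rw [← integral_Ici_eq_integral_Ioi, setIntegral_indicator measurableSet_Ici,
    Set.Ici_inter_Ici, sup_eq_right.2 hx, integral_Ici_eq_integral_Ioi, integral_const_mul,
    integral_exp_mul_complex_Ioi (by simpa using hw)]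
  field_simp

theorem setIntegral_norm_ite_mul_cexp (c : ℂ) {x : ℝ} (hx : 0 ≤ x) {w : ℂ} (hw : 0 < w.re) :
    ∫ t : ℝ in Set.Ioi 0, ‖(if x ≤ t then c else 0) * Complex.exp (-w * t)‖ =
      ‖c‖ * Real.exp (-w.re * x) / w.re := by
  have h := setIntegral_ite_mul_cexp (‖c‖ : ℂ) hx (w := (w.re : ℂ)) (by simpa using hw)
  rw [← Complex.ofReal_inj, ← integral_complex_ofReal]
  push_cast
  rw [← h]
  refine integral_congr_ae (ae_of_all _ fun t ↦ ?_)
  simp only [norm_mul_cexp_neg_mul]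
  split_ifs <;> simp

theorem setIntegral_summatory_mul_cexp [Countable ι] {a : ι → ℂ} (ha : DirichletSummable a u)
    {w : ℂ} (hw : 1 < w.re) :
    ∫ t in Set.Ioi 0, summatory a u t * Complex.exp (-w * t) = dirichletSum a u w / w := by
  have hw0 : 0 < w.re := one_pos.trans hw
  have h := hasSum_integral_of_summable_integral_norm
    (F := fun i (t : ℝ) ↦ (if u i ≤ t then a i else 0) * Complex.exp (-w * t))
    (μ := volume.restrict (Set.Ioi 0)) (fun i ↦ integrableOn_ite_mul_cexp _ _ hw0) (by
      simp_rw [setIntegral_norm_ite_mul_cexp _ (ha.freq_nonneg _) hw0]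
      exact (ha.summable _ hw).div_const _)
  simp_rw [setIntegral_ite_mul_cexp _ (ha.freq_nonneg _) hw0, tsum_mul_right] at h
  rw [dirichletSum, ← tsum_div_const, h.tsum_eq]
  rfl

end DirichletSummable

/-- `F` minus the polar part `A / (s - 1)` has a limit, from within `re s > 1`, at every point of
`re s ≥ 1`. -/
def ExtendsWithSimplePole (F : ℂ → ℂ) (A : ℂ) : Prop :=
  ∀ s₀ : ℂ, 1 ≤ s₀.re → ∃ l, Tendsto (fun s ↦ F s - A / (s - 1)) (𝓝[{s | 1 < s.re}] s₀) (𝓝 l)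

namespace ExtendsWithSimplePole

variable {F G : ℂ → ℂ} {A B : ℂ}

theorem congr (hF : ExtendsWithSimplePole F A) (h : ∀ s : ℂ, 1 < s.re → F s = G s) :
    ExtendsWithSimplePole G A := by
  intro s₀ hs₀
  obtain ⟨l, hl⟩ := hF s₀ hs₀
  refine ⟨l, hl.congr' ?_⟩
  filter_upwards [self_mem_nhdsWithin] with s hs
  rw [h s hs]

theorem add (hF : ExtendsWithSimplePole F A) (hG : ExtendsWithSimplePole G B) :
    ExtendsWithSimplePole (fun s ↦ F s + G s) (A + B) := by
  intro s₀ hs₀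
  obtain ⟨l, hl⟩ := hF s₀ hs₀
  obtain ⟨m, hm⟩ := hG s₀ hs₀
  exact ⟨l + m, (hl.add hm).congr fun s ↦ by ring⟩

theorem const_mul (hF : ExtendsWithSimplePole F A) (c : ℂ) :
    ExtendsWithSimplePole (fun s ↦ c * F s) (c * A) := by
  intro s₀ hs₀
  obtain ⟨l, hl⟩ := hF s₀ hs₀
  exact ⟨c * l, (hl.const_mul c).congr fun s ↦ by ring⟩

theorem conj (hF : ExtendsWithSimplePole F A) :
    ExtendsWithSimplePole (fun s ↦ (starRingEnd ℂ) (F ((starRingEnd ℂ) s)))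
      ((starRingEnd ℂ) A) := by
  intro s₀ hs₀
  obtain ⟨l, hl⟩ := hF ((starRingEnd ℂ) s₀) (by simpa using hs₀)
  have hconj : Tendsto (starRingEnd ℂ) (𝓝[{s | 1 < s.re}] s₀)
      (𝓝[{s | 1 < s.re}] (starRingEnd ℂ) s₀) :=
    Complex.continuous_conj.continuousWithinAt.tendsto_nhdsWithin fun s hs ↦ by simpa using hs
  refine ⟨(starRingEnd ℂ) l, ((Complex.continuous_conj.tendsto _).comp (hl.comp hconj)).congr
    fun s ↦ ?_⟩
  simp

theorem exists_tendsto_shift (hF : ExtendsWithSimplePole F A) {z₀ : ℂ} (hz₀ : 0 ≤ z₀.re) :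
    ∃ l, Tendsto (fun z ↦ F (1 + z) / (1 + z) - A / z) (𝓝[{z | 0 < z.re}] z₀) (𝓝 l) := by
  obtain ⟨l, hl⟩ := hF (1 + z₀) (by simpa using hz₀)
  have hne {z : ℂ} (hz : 0 ≤ z.re) : 1 + z ≠ 0 := fun h ↦ by
    have := congrArg Complex.re h
    simp only [Complex.add_re, Complex.one_re, Complex.zero_re] at this
    linarith
  have hshift : Tendsto (fun z : ℂ ↦ 1 + z) (𝓝[{z | 0 < z.re}] z₀) (𝓝[{s | 1 < s.re}] (1 + z₀)) :=
    (continuous_const_add (1 : ℂ)).continuousWithinAt.tendsto_nhdsWithin fun z hz ↦ by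
      simpa using hz
  have hlim := hshift.mono_right nhdsWithin_le_nhds
  refine ⟨l / (1 + z₀) - A / (1 + z₀), (((hl.comp hshift).div hlim (hne hz₀)).sub
    (tendsto_const_nhds.div hlim (hne hz₀))).congr' ?_⟩
  filter_upwards [self_mem_nhdsWithin] with z (hz : 0 < z.re)
  have hz0 : z ≠ 0 := by
    rintro rfl
    simp at hz
  have hz1 := hne hz.le
  change (F (1 + z) - A / (1 + z - 1)) / (1 + z) - A / (1 + z) = _
  rw [add_sub_cancel_left]
  field_simp
  ring

end ExtendsWithSimplePole

theorem DirichletSummable.hasLaplaceBoundary {ι : Type*} [Countable ι] {a u : ι → ℝ}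
    (ha : DirichletSummable a u) (ha0 : ∀ i, 0 ≤ a i) {A : ℝ}
    (hpole : ExtendsWithSimplePole (dirichletSum (fun i ↦ a i) u) A) :
    ∃ g, HasLaplaceBoundary (fun v ↦ Real.exp (-v) * summatory a u v) A g := by
  set f : ℂ → ℂ := fun z ↦ dirichletSum (fun i ↦ (a i : ℂ)) u (1 + z) / (1 + z) - A / z
  have hcont : ContinuousOn (extendFrom {z : ℂ | 0 < z.re} f) {z | 0 ≤ z.re} :=
    continuousOn_extendFrom (by rw [Complex.closure_setOfPred_lt_re])
      fun z hz ↦ hpole.exists_tendsto_shift hz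
  refine ⟨_, fun ε hε ↦ ha.integrableOn_exp_neg_mul_summatory ha0 hε, hcont, fun z hz ↦ ?_⟩
  have hext : extendFrom {z : ℂ | 0 < z.re} f z = f z := by
    obtain ⟨l, hl⟩ := hpole.exists_tendsto_shift hz.le
    have hz' : z ∈ {z : ℂ | 0 < z.re} := hz
    rw [extendFrom_eq (subset_closure hz') hl]
    exact tendsto_nhds_unique (hl.mono_left (pure_le_nhdsWithin hz)) (tendsto_pure_nhds _ z)
  have haC : DirichletSummable (fun i ↦ (a i : ℂ)) u := ha.of_norm_le (C := 1) fun i ↦ by simp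
  rw [hext, add_sub_cancel, ← haC.setIntegral_summatory_mul_cexp (by simpa using hz)]
  refine integral_congr_ae (ae_of_all _ fun t ↦ ?_)
  have hexp : Complex.exp (-(1 + z) * t) = Complex.exp (-t) * Complex.exp (-z * t) := by
    rw [← Complex.exp_add]
    ring_nf
  simp only [hexp, summatory]
  push_cast [apply_ite]
  ring

theorem DirichletSummable.tendsto_summatory_of_nonneg {ι : Type*} [Countable ι] {a u : ι → ℝ}
    (ha : DirichletSummable a u) (ha0 : ∀ i, 0 ≤ a i) {A : ℝ}
    (hpole : ExtendsWithSimplePole (dirichletSum (fun i ↦ a i) u) A) :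
    Tendsto (fun v ↦ Real.exp (-v) * summatory a u v) atTop (𝓝 A) := by
  obtain ⟨g, hg⟩ := ha.hasLaplaceBoundary ha0 hpole
  have hnonneg (v : ℝ) : 0 ≤ Real.exp (-v) * summatory a u v :=
    mul_nonneg (Real.exp_nonneg _) (tsum_nonneg fun i ↦ ite_nonneg (ha0 i) le_rfl)
  refine (hg.hasAverageLimit hnonneg).tendsto hnonneg fun v w hvw ↦ ?_
  rw [← mul_assoc, ← Real.exp_add, show w - v + -w = -v by ring]
  exact mul_le_mul_of_nonneg_left (ha.monotone_summatory ha0 hvw) (Real.exp_nonneg _)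

section Domination

variable {ι : Type*} {a u : ι → ℝ} {b : ι → ℂ} {A : ℝ} {B : ℂ}

theorem dirichletSum_conj (b : ι → ℂ) (u : ι → ℝ) (s : ℂ) :
    dirichletSum (fun i ↦ (starRingEnd ℂ) (b i)) u s =
      (starRingEnd ℂ) (dirichletSum b u ((starRingEnd ℂ) s)) := by
  simp [dirichletSum, Complex.conj_tsum, ← Complex.exp_conj]

theorem ExtendsWithSimplePole.add_re_mul (ha : DirichletSummable a u) (hb : DirichletSummable b u)
    (hA : ExtendsWithSimplePole (dirichletSum (fun i ↦ a i) u) A)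
    (hB : ExtendsWithSimplePole (dirichletSum b u) B) (c : ℂ) :
    ExtendsWithSimplePole (dirichletSum (fun i ↦ ((a i + (c * b i).re : ℝ) : ℂ)) u)
      ((A + (c * B).re : ℝ) : ℂ) := by
  have hpole := (hA.add (hB.const_mul (c / 2))).add (hB.conj.const_mul ((starRingEnd ℂ) c / 2))
  have hres : (A : ℂ) + c / 2 * B + (starRingEnd ℂ) c / 2 * (starRingEnd ℂ) B =
      ((A + (c * B).re : ℝ) : ℂ) := by
    push_cast
    rw [Complex.re_eq_add_conj, map_mul]
    ring
  rw [hres] at hpole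
  refine hpole.congr fun s hs ↦ ?_
  have haC : DirichletSummable (fun i ↦ (a i : ℂ)) u := ha.of_norm_le (C := 1) fun i ↦ by simp
  have hbC : DirichletSummable (fun i ↦ (starRingEnd ℂ) (b i)) u :=
    hb.of_norm_le (C := 1) fun i ↦ by simp
  rw [← dirichletSum_conj]
  refine (((haC.hasSum hs).add ((hb.hasSum hs).mul_left (c / 2))).add
    ((hbC.hasSum hs).mul_left ((starRingEnd ℂ) c / 2))).tsum_eq.symm.trans (tsum_congr fun i ↦ ?_)
  push_cast
  rw [Complex.re_eq_add_conj, map_mul]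
  ring

theorem DirichletSummable.tendsto_re_mul_summatory [Countable ι] (ha : DirichletSummable a u)
    (hba : ∀ i, ‖b i‖ ≤ a i) (hA : ExtendsWithSimplePole (dirichletSum (fun i ↦ a i) u) A)
    (hB : ExtendsWithSimplePole (dirichletSum b u) B) {c : ℂ} (hc : ‖c‖ ≤ 1) :
    Tendsto (fun v ↦ (c * (Real.exp (-v) * summatory b u v)).re) atTop (𝓝 (c * B).re) := by
  have hb : DirichletSummable b u :=
    ha.of_norm_le (C := 1) fun i ↦ by simpa using (hba i).trans (le_abs_self _)
  have hcb (i : ι) : |(c * b i).re| ≤ a i := by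
    refine (Complex.abs_re_le_norm _).trans ?_
    rw [norm_mul]
    exact (mul_le_of_le_one_left (norm_nonneg _) hc).trans (hba i)
  have hre : DirichletSummable (fun i ↦ (c * b i).re) u :=
    ha.of_norm_le (C := 1) fun i ↦ by simpa using (hcb i).trans (le_abs_self _)
  have hsum : DirichletSummable (fun i ↦ a i + (c * b i).re) u :=
    ha.of_norm_le (C := 2) fun i ↦ (norm_add_le _ _).trans (by
      have := (hcb i).trans (le_abs_self _)
      simp only [Real.norm_eq_abs]
      linarith)
  have hlim := (hsum.tendsto_summatory_of_nonneg
    (fun i ↦ by linarith [(abs_le.1 (hcb i)).1]) (hA.add_re_mul ha hb hB c)).sub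
    (ha.tendsto_summatory_of_nonneg (fun i ↦ (norm_nonneg _).trans (hba i)) hA)
  rw [add_sub_cancel_left] at hlim
  refine hlim.congr fun v ↦ ?_
  have hadd : summatory (fun i ↦ a i + (c * b i).re) u v =
      summatory a u v + (c * summatory b u v).re := by
    rw [summatory, summatory, summatory, ← tsum_mul_left,
      Complex.re_tsum ((hb.summable_ite v).mul_left c), ← (ha.summable_ite v).tsum_add]
    · refine tsum_congr fun i ↦ ?_
      split_ifs <;> simp
    · exact (hre.summable_ite v).congr fun i ↦ by split_ifs <;> simp
  rw [hadd, mul_add, add_sub_cancel_left, ← Complex.re_ofReal_mul]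
  ring_nf

theorem DirichletSummable.tendsto_summatory_of_norm_le [Countable ι] (ha : DirichletSummable a u)
    (hba : ∀ i, ‖b i‖ ≤ a i) (hA : ExtendsWithSimplePole (dirichletSum (fun i ↦ a i) u) A)
    (hB : ExtendsWithSimplePole (dirichletSum b u) B) :
    Tendsto (fun v ↦ Real.exp (-v) * summatory b u v) atTop (𝓝 B) := by
  have hre := ha.tendsto_re_mul_summatory hba hA hB (c := 1) (by simp)
  have him := ha.tendsto_re_mul_summatory hba hA hB (c := -Complex.I) (by simp)
  have h := ((Complex.continuous_ofReal.tendsto _).comp hre).add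
    (((Complex.continuous_ofReal.tendsto _).comp him).mul_const Complex.I)
  have hsplit (z : ℂ) : (((1 * z).re : ℝ) : ℂ) + ((-Complex.I * z).re : ℝ) * Complex.I = z := by
    simp [Complex.re_add_im]
  rw [hsplit] at h
  exact h.congr fun v ↦ hsplit _

end Domination

theorem mem_closure_lt_re {σ : ℝ} {s : ℂ} (hs : σ ≤ s.re) : s ∈ closure {s : ℂ | σ < s.re} := by
  rwa [Complex.closure_setOfPred_lt_re]

theorem DirichletSummable.tendsto_dirichletSum_atTop {ι : Type*} {a : ι → ℂ} {u : ι → ℝ}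
    (ha : DirichletSummable a u) :
    Tendsto (fun σ : ℝ ↦ dirichletSum a u σ) atTop (𝓝 (∑' i, if u i = 0 then a i else 0)) := by
  refine tendsto_tsum_of_dominated_convergence (ha.summable 2 one_lt_two) (fun i ↦ ?_) ?_
  · split_ifs with hi
    · simp [hi]
    · have hexp : Tendsto (fun σ : ℝ ↦ Real.exp (-σ * u i)) atTop (𝓝 0) :=
        Real.tendsto_exp_atBot.comp (tendsto_neg_atTop_atBot.atBot_mul_const
          ((ha.freq_nonneg i).lt_of_ne' hi))
      rw [tendsto_zero_iff_norm_tendsto_zero]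
      simpa only [norm_mul_cexp_neg_mul, Complex.ofReal_re, mul_zero] using hexp.const_mul ‖a i‖
  · filter_upwards [eventually_ge_atTop 2] with σ hσ i
    rw [norm_mul_cexp_neg_mul, Complex.ofReal_re]
    have := ha.freq_nonneg i
    gcongr

theorem DirichletSummable.not_eventually_dirichletSum_eq_zero {ι : Type*} {a : ι → ℂ} {u : ι → ℝ}
    (ha : DirichletSummable a u) (hne : ∑' i, (if u i = 0 then a i else 0) ≠ 0) {s₀ : ℂ}
    (hs₀ : 1 ≤ s₀.re) : ¬ ∀ᶠ s in 𝓝[{s | 1 < s.re}] s₀, dirichletSum a u s = 0 := by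
  intro hev
  have : (𝓝[{s : ℂ | 1 < s.re}] s₀).NeBot :=
    mem_closure_iff_nhdsWithin_neBot.1 (mem_closure_lt_re hs₀)
  obtain ⟨s₁, hs₁, hs₁'⟩ := ((eventually_eventually_nhdsWithin.2 hev).and
    eventually_mem_nhdsWithin).exists
  rw [(isOpen_lt_re 1).nhdsWithin_eq hs₁'] at hs₁
  have hdiff : DifferentiableOn ℂ (dirichletSum a u) {s | 1 < s.re} :=
    fun s hs ↦ (ha.hasDerivAt hs).differentiableAt.differentiableWithinAt
  have hana := hdiff.analyticOnNhd (isOpen_lt_re 1)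
  have hzero := hana.eqOn_zero_of_preconnected_of_eventuallyEq_zero
    (convex_halfSpace_re_gt 1).isPreconnected hs₁' hs₁
  refine hne (tendsto_nhds_unique ha.tendsto_dirichletSum_atTop
    (tendsto_const_nhds.congr' ?_))
  filter_upwards [eventually_gt_atTop 1] with σ hσ
  exact (hzero (show 1 < (σ : ℂ).re from hσ)).symm

theorem DirichletSummable.summable_of_eventually_norm_le {ι : Type*} {a : ι → ℂ} {u : ι → ℝ}
    (ha : DirichletSummable a u) (ha₀ : ∀ i, (‖a i‖ : ℂ) = a i) {C : ℝ}
    (hC : ∀ᶠ s in 𝓝[{s | 1 < s.re}] 1, ‖dirichletSum a u s‖ ≤ C) :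
    Summable fun i ↦ ‖a i‖ * Real.exp (-u i) := by
  have hreal : Tendsto (fun σ : ℝ ↦ (σ : ℂ)) (𝓝[>] 1) (𝓝[{s | 1 < s.re}] 1) :=
    tendsto_nhdsWithin_iff.2 ⟨(Complex.continuous_ofReal.tendsto' 1 1 (by simp)).mono_left
      nhdsWithin_le_nhds, eventually_mem_nhdsWithin.mono fun _ hσ ↦ hσ⟩
  have hnorm {σ : ℝ} : dirichletSum a u σ = (∑' i, ‖a i‖ * Real.exp (-σ * u i) : ℝ) := by
    rw [Complex.ofReal_tsum]
    refine tsum_congr fun i ↦ ?_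
    push_cast
    rw [ha₀]
  refine summable_of_sum_le (c := C) (fun i ↦ by positivity) fun S ↦ ?_
  have hlim : Tendsto (fun σ : ℝ ↦ ∑ i ∈ S, ‖a i‖ * Real.exp (-σ * u i)) (𝓝[>] 1)
      (𝓝 (∑ i ∈ S, ‖a i‖ * Real.exp (-u i))) :=
    (Continuous.tendsto' (by fun_prop) 1 _ (by simp)).mono_left nhdsWithin_le_nhds
  refine le_of_tendsto hlim ?_
  filter_upwards [hreal.eventually hC, self_mem_nhdsWithin] with σ hσ hσ₁
  calc ∑ i ∈ S, ‖a i‖ * Real.exp (-σ * u i)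
      ≤ ∑' i, ‖a i‖ * Real.exp (-σ * u i) :=
        (ha.summable σ hσ₁).sum_le_tsum S fun i _ ↦ by positivity
    _ ≤ ‖dirichletSum a u σ‖ := by
        rw [hnorm, Complex.norm_real]
        exact le_abs_self _
    _ ≤ C := hσ

/-! ### Orders of vanishing at boundary points -/

/-- On `U`, close to the point `s₀` (typically a boundary point of `U`), `F` agrees with a
meromorphic function of order `n` at `s₀`; a pole has negative order. -/
def HasOrderWithinAt (F : ℂ → ℂ) (U : Set ℂ) (s₀ : ℂ) (n : ℤ) : Prop :=
  ∃ G, MeromorphicAt G s₀ ∧ meromorphicOrderAt G s₀ = n ∧ F =ᶠ[𝓝[U] s₀] G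

theorem exists_hasOrderWithinAt_of_eq_mul {F C c : ℂ → ℂ} {U : Set ℂ} {s₀ : ℂ} (hs₀ : s₀ ∉ U)
    (hC : AnalyticAt ℂ C s₀) (hc : AnalyticAt ℂ c s₀) {m : ℕ} (hm : analyticOrderAt c s₀ = m)
    (hCF : ∀ s ∈ U, C s = c s * F s) (hF : ¬ ∀ᶠ s in 𝓝[U] s₀, F s = 0) :
    ∃ n : ℕ, HasOrderWithinAt F U s₀ (n - m) := by
  have hU : U ⊆ {s₀}ᶜ := Set.subset_compl_singleton_iff.2 hs₀
  have hcne : ∀ᶠ s in 𝓝[U] s₀, c s ≠ 0 := by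
    refine (hc.eventually_eq_zero_or_eventually_ne_zero.resolve_left fun h ↦ ?_).filter_mono
      (nhdsWithin_mono _ hU)
    rw [analyticOrderAt_eq_top.2 h] at hm
    exact ENat.top_ne_natCast m hm
  obtain ⟨n, hn⟩ : ∃ n : ℕ, analyticOrderAt C s₀ = n := by
    refine ⟨_, (ENat.natCast_toNat fun htop ↦ hF ?_).symm⟩
    filter_upwards [(analyticOrderAt_eq_top.1 htop).filter_mono nhdsWithin_le_nhds, hcne,
      self_mem_nhdsWithin] with s h0 hcs hs
    exact (mul_eq_zero.1 ((hCF s hs).symm.trans h0)).resolve_left hcs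
  refine ⟨n, C / c, hC.meromorphicAt.div hc.meromorphicAt, ?_, ?_⟩
  · rw [meromorphicOrderAt_div hC.meromorphicAt hc.meromorphicAt, hC.meromorphicOrderAt_eq,
      hc.meromorphicOrderAt_eq, hn, hm]
    rfl
  · filter_upwards [hcne, self_mem_nhdsWithin] with s hcs hs
    rw [Pi.div_apply, hCF s hs, mul_div_cancel_left₀ _ hcs]

namespace HasOrderWithinAt

variable {F : ℂ → ℂ} {U : Set ℂ} {s₀ : ℂ} {n : ℤ}

theorem exists_eventually_norm_le (h : HasOrderWithinAt F U s₀ n) (hs₀ : s₀ ∉ U) (hn : 0 ≤ n) :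
    ∃ M, ∀ᶠ s in 𝓝[U] s₀, ‖F s‖ ≤ M := by
  obtain ⟨G, hG, hord, hFG⟩ := h
  have hord0 : 0 ≤ meromorphicOrderAt G s₀ := hord ▸ mod_cast hn
  obtain ⟨l, hl⟩ := (tendsto_nhds_iff_meromorphicOrderAt_nonneg hG).2 hord0
  refine ⟨‖l‖ + 1, ?_⟩
  filter_upwards [hFG, (hl.norm.eventually_le_const (lt_add_one _)).filter_mono
    (nhdsWithin_mono _ (Set.subset_compl_singleton_iff.2 hs₀))] with s hFs hGs
  rwa [hFs]

theorem exists_logDeriv_eq (h : HasOrderWithinAt F U s₀ n) (hU : IsOpen U) (hs₀ : s₀ ∉ U) :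
    ∃ φ, ContinuousAt φ s₀ ∧
      ∀ᶠ s in 𝓝[U] s₀, F s ≠ 0 ∧ logDeriv F s = n / (s - s₀) + φ s := by
  obtain ⟨G, hG, hord, hFG⟩ := h
  obtain ⟨g, hg, hg0, hGg⟩ := (meromorphicOrderAt_eq_int_iff hG).1 hord
  have hFg : ∀ᶠ s in 𝓝[U] s₀, F s = (s - s₀) ^ n * g s := by
    filter_upwards [hFG,
      hGg.filter_mono (nhdsWithin_mono _ (Set.subset_compl_singleton_iff.2 hs₀))] with s hFs hGs
    rw [hFs, hGs, smul_eq_mul]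
  refine ⟨logDeriv g, hg.deriv.continuousAt.div hg.continuousAt hg0, ?_⟩
  filter_upwards [eventually_eventually_nhdsWithin.2 hFg, self_mem_nhdsWithin,
    hg.eventually_analyticAt.filter_mono nhdsWithin_le_nhds,
    (hg.continuousAt.eventually_ne hg0).filter_mono nhdsWithin_le_nhds] with s hFs hs hgs hgs0
  rw [hU.nhdsWithin_eq hs] at hFs
  have hne : s - s₀ ≠ 0 := sub_ne_zero.2 fun h ↦ hs₀ (h ▸ hs)
  have hdiff : DifferentiableAt ℂ (fun s ↦ s - s₀) s := by fun_prop
  refine ⟨hFs.self_of_nhds ▸ mul_ne_zero (zpow_ne_zero n hne) hgs0, ?_⟩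
  rw [(logDeriv_congr_nhds hFs).eq_of_nhds, logDeriv_mul (f := fun x ↦ (x - s₀) ^ n) s
    (zpow_ne_zero n hne) hgs0 (hdiff.zpow (Or.inl hne)) hgs.differentiableAt,
    logDeriv_fun_zpow hdiff, logDeriv_apply, deriv_sub_const, deriv_id'', mul_one_div]

end HasOrderWithinAt

theorem tendsto_mul_re_of_eventually_eq_div_add {F φ : ℂ → ℂ} {U : Set ℂ} {s₀ : ℂ} {c : ℝ}
    (hφ : ContinuousAt φ s₀) (hF : ∀ᶠ s in 𝓝[U] s₀, F s = c / (s - s₀) + φ s)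
    (hmem : ∀ ε : ℝ, 0 < ε → s₀ + ε ∈ U) :
    Tendsto (fun ε : ℝ ↦ ε * (F (s₀ + ε)).re) (𝓝[>] 0) (𝓝 c) := by
  have hto : Tendsto (fun ε : ℝ ↦ s₀ + ε) (𝓝[>] 0) (𝓝[U] s₀) :=
    tendsto_nhdsWithin_iff.2
      ⟨(Continuous.tendsto' (by fun_prop) 0 s₀ (by simp)).mono_left nhdsWithin_le_nhds,
        eventually_mem_nhdsWithin.mono hmem⟩
  have hlim : Tendsto (fun ε : ℝ ↦ c + ε * (φ (s₀ + ε)).re) (𝓝[>] 0)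
      (𝓝 (c + 0 * (φ s₀).re)) :=
    ((tendsto_id.mono_left nhdsWithin_le_nhds).mul ((Complex.continuous_re.tendsto _).comp
      (hφ.tendsto.comp (hto.mono_right nhdsWithin_le_nhds)))).const_add _
  rw [zero_mul, add_zero] at hlim
  refine hlim.congr' ?_
  filter_upwards [hto.eventually hF, self_mem_nhdsWithin] with ε hεF (hε : 0 < ε)
  rw [hεF, add_sub_cancel_left, ← Complex.ofReal_div, Complex.add_re, Complex.ofReal_re, mul_add,
    mul_div_cancel₀ c hε.ne']

/-! ### Hecke characters and Hecke `L`-functions of `ℤ[i]` -/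

theorem one_le_norm_toComplex {ω : GaussianInt} (hω : ω ≠ 0) : 1 ≤ ‖(ω : ℂ)‖ := by
  have h : (1 : ℝ) ≤ (ω.norm : ℝ) := by exact_mod_cast GaussianInt.norm_pos.2 hω
  rwa [GaussianInt.intCast_real_norm, Complex.normSq_eq_norm_sq,
    one_le_sq_iff₀ (norm_nonneg _)] at h

theorem norm_toComplex_eq_one_iff {ω : GaussianInt} : ‖(ω : ℂ)‖ = 1 ↔ IsUnit ω := by
  rw [← pow_eq_one_iff_of_nonneg (norm_nonneg _) two_ne_zero, ← Complex.normSq_eq_norm_sq,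
    ← GaussianInt.intCast_real_norm, Int.cast_eq_one, Zsqrtd.norm_eq_one_iff' (by norm_num)]

theorem norm_re_im_le_norm_toComplex (ω : GaussianInt) :
    ‖(![ω.re, ω.im] : Fin 2 → ℤ)‖ ≤ ‖(ω : ℂ)‖ := by
  refine (pi_norm_le_iff_of_nonneg (norm_nonneg _)).2 fun i ↦ ?_
  fin_cases i
  · simpa [Int.norm_eq_abs] using Complex.abs_re_le_norm (ω : ℂ)
  · simpa [Int.norm_eq_abs] using Complex.abs_im_le_norm (ω : ℂ)

theorem summable_norm_toComplex_rpow {r : ℝ} (hr : 2 < r) :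
    Summable fun ω : GaussianInt ↦ ‖(ω : ℂ)‖ ^ (-r) := by
  have hinj : Function.Injective fun ω : GaussianInt ↦ (![ω.re, ω.im] : Fin 2 → ℤ) :=
    fun a b hab ↦ Zsqrtd.ext (congrFun hab 0) (congrFun hab 1)
  refine .of_nonneg_of_le (fun ω ↦ by positivity) (fun ω ↦ ?_)
    ((EisensteinSeries.summable_one_div_norm_rpow hr).comp_injective hinj)
  rcases eq_or_ne ω 0 with rfl | hω
  · rw [GaussianInt.toComplex_zero, norm_zero, Real.zero_rpow (by linarith)]
    exact Real.rpow_nonneg (norm_nonneg _) _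
  · have hpos : 0 < ‖(![ω.re, ω.im] : Fin 2 → ℤ)‖ :=
      norm_pos_iff.2 fun h ↦ hω (hinj (h.trans (by ext i; fin_cases i <;> rfl)))
    exact Real.rpow_le_rpow_of_nonpos hpos (norm_re_im_le_norm_toComplex ω) (by linarith)

theorem one_div_le_two_mul_sum_inv_sq_norm (m : ℕ) :
    1 / ((m + 1 : ℕ) : ℝ) ≤
      2 * ∑ b : Fin (m + 1), (‖((⟨(m + 1 : ℕ), (b : ℕ)⟩ : GaussianInt) : ℂ)‖ ^ 2)⁻¹ := by
  have hterm : ∀ b : Fin (m + 1), (2 * ((m + 1 : ℕ) : ℝ) ^ 2)⁻¹ ≤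
      (‖((⟨(m + 1 : ℕ), (b : ℕ)⟩ : GaussianInt) : ℂ)‖ ^ 2)⁻¹ := fun b ↦ by
    have hb : ((b : ℕ) : ℝ) ^ 2 ≤ ((m + 1 : ℕ) : ℝ) ^ 2 := by
      gcongr
      exact b.2.le
    rw [← Complex.normSq_eq_norm_sq, Complex.normSq_apply, GaussianInt.re_toComplex,
      GaussianInt.im_toComplex, Int.cast_natCast, Int.cast_natCast, ← sq, ← sq]
    gcongr
    linarith
  calc 1 / ((m + 1 : ℕ) : ℝ) = 2 * ∑ _b : Fin (m + 1), (2 * ((m + 1 : ℕ) : ℝ) ^ 2)⁻¹ := by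
        rw [Finset.sum_const, Finset.card_univ, Fintype.card_fin, nsmul_eq_mul]
        field_simp
    _ ≤ _ := mul_le_mul_of_nonneg_left (Finset.sum_le_sum fun b _ ↦ hterm b) two_pos.le

theorem not_summable_inv_sq_norm_toComplex :
    ¬ Summable fun ω : GaussianInt ↦ (‖(ω : ℂ)‖ ^ 2)⁻¹ := by
  intro hs
  have hinj : Function.Injective fun p : (m : ℕ) × Fin (m + 1) ↦
      (⟨(p.1 + 1 : ℕ), (p.2 : ℕ)⟩ : GaussianInt) := by
    rintro ⟨m, a⟩ ⟨n, b⟩ h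
    simp only [Zsqrtd.mk.injEq, Nat.cast_inj, Nat.add_right_cancel_iff] at h
    obtain ⟨rfl, h⟩ := h
    rw [Fin.ext h]
  have hsigma := ((summable_sigma_of_nonneg fun _ ↦ inv_nonneg.2 (sq_nonneg _)).1
    (hs.comp_injective hinj)).2
  simp only [tsum_fintype] at hsigma
  exact Real.not_summable_one_div_natCast ((summable_nat_add_iff 1).1
    (.of_nonneg_of_le (fun m ↦ by positivity) one_div_le_two_mul_sum_inv_sq_norm
      (hsigma.mul_left 2)))

/-- The function `z ↦ log |z|²`, which on `ℤ[i]` is the logarithm of the norm. -/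
noncomputable def logSq (z : ℂ) : ℝ := 2 * Real.log ‖z‖

theorem logSq_mul {z w : ℂ} (hz : z ≠ 0) (hw : w ≠ 0) : logSq (z * w) = logSq z + logSq w := by
  rw [logSq, norm_mul, Real.log_mul (norm_ne_zero_iff.2 hz) (norm_ne_zero_iff.2 hw), mul_add]
  rfl

theorem logSq_nonneg (ω : GaussianInt) : 0 ≤ logSq ω := by
  rcases eq_or_ne ω 0 with rfl | hω
  · simp [logSq]
  · exact mul_nonneg two_pos.le (Real.log_nonneg (one_le_norm_toComplex hω))

theorem exp_mul_logSq {z : ℂ} (hz : z ≠ 0) (x : ℝ) : Real.exp (x * logSq z) = ‖z‖ ^ (2 * x) := by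
  rw [Real.rpow_def_of_pos (norm_pos_iff.2 hz), logSq]
  ring_nf

/-- The character `z ↦ (z / |z|) ^ k` of `ℂˣ`, extended by `0`. Its restriction to `ℤ[i]` is
invariant under units, and hence a Hecke character, exactly when `4 ∣ k`. -/
noncomputable def heckeChar (k : ℤ) : ℂ →*₀ ℂ where
  toFun z := if z = 0 then 0 else (z / ‖z‖) ^ k
  map_zero' := if_pos rfl
  map_one' := by simp
  map_mul' z w := by
    by_cases hz : z = 0 <;> by_cases hw : w = 0 <;>
      simp [hz, hw, mul_div_mul_comm, mul_zpow]

theorem heckeChar_of_ne_zero (k : ℤ) {z : ℂ} (hz : z ≠ 0) : heckeChar k z = (z / ‖z‖) ^ k :=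
  if_neg hz

theorem heckeChar_eq_exp (k : ℤ) {z : ℂ} (hz : z ≠ 0) :
    heckeChar k z = Complex.exp (k * (z.arg * Complex.I)) := by
  rw [heckeChar_of_ne_zero k hz, Complex.exp_int_mul]
  congr 1
  rw [div_eq_iff (by simpa using hz), mul_comm, Complex.norm_mul_exp_arg_mul_I]

theorem norm_heckeChar (k : ℤ) {z : ℂ} (hz : z ≠ 0) : ‖heckeChar k z‖ = 1 := by
  rw [heckeChar_eq_exp k hz, Complex.norm_exp]
  simp

theorem norm_heckeChar_le_one (k : ℤ) (z : ℂ) : ‖heckeChar k z‖ ≤ 1 := by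
  rcases eq_or_ne z 0 with rfl | hz
  · simp
  · exact (norm_heckeChar k hz).le

/-- The completely multiplicative function `z ↦ (z / |z|) ^ k * |z| ^ (-2 s)`, extended by `0`:
the terms of the Hecke `L`-series. -/
noncomputable def heckeTerm (k : ℤ) (s : ℂ) : ℂ →*₀ ℂ where
  toFun z := heckeChar k z * Complex.exp (-s * logSq z)
  map_zero' := by simp
  map_one' := by simp [logSq]
  map_mul' z w := by
    by_cases hz : z = 0
    · simp [hz]
    by_cases hw : w = 0
    · simp [hw]
    rw [map_mul, logSq_mul hz hw, Complex.ofReal_add, mul_add, Complex.exp_add]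
    ring

theorem heckeTerm_apply (k : ℤ) (s z : ℂ) :
    heckeTerm k s z = heckeChar k z * Complex.exp (-s * logSq z) := rfl

theorem norm_heckeTerm (k : ℤ) (s : ℂ) {z : ℂ} (hz : z ≠ 0) :
    ‖heckeTerm k s z‖ = ‖z‖ ^ (-(2 * s.re)) := by
  rw [heckeTerm_apply, norm_mul_cexp_neg_mul, norm_heckeChar k hz, exp_mul_logSq hz, one_mul,
    mul_neg]

theorem norm_heckeTerm_le (k : ℤ) {s : ℂ} {σ : ℝ} (hs : σ ≤ s.re) (ω : GaussianInt) :
    ‖heckeTerm k s ω‖ ≤ ‖(ω : ℂ)‖ ^ (-(2 * σ)) := by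
  rcases eq_or_ne ω 0 with rfl | hω
  · rw [GaussianInt.toComplex_zero, map_zero, norm_zero]
    positivity
  · rw [norm_heckeTerm k s (by simpa using hω)]
    exact Real.rpow_le_rpow_of_exponent_le (one_le_norm_toComplex hω) (by linarith)

theorem heckeTerm_eq_exp_log (k : ℤ) (s : ℂ) {z : ℂ} (hz : z ≠ 0) :
    heckeTerm k s z =
      Complex.exp (k * ((Complex.log z).im * Complex.I) - 2 * s * (Complex.log z).re) := by
  rw [heckeTerm_apply, heckeChar_eq_exp k hz, ← Complex.exp_add, Complex.log_im, Complex.log_re,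
    logSq]
  push_cast
  ring_nf

theorem differentiable_heckeTerm (k : ℤ) (z : ℂ) : Differentiable ℂ fun s ↦ heckeTerm k s z := by
  simp only [heckeTerm_apply]
  fun_prop

theorem norm_intCast_mul_I_sub_le (k : ℤ) (s ℓ : ℂ) :
    ‖(k : ℂ) * (ℓ.im * Complex.I) - 2 * s * ℓ.re‖ ≤ (|k| + 2 * ‖s‖) * ‖ℓ‖ :=
  calc ‖(k : ℂ) * (ℓ.im * Complex.I) - 2 * s * ℓ.re‖
      ≤ ‖(k : ℂ) * (ℓ.im * Complex.I)‖ + ‖2 * s * ℓ.re‖ := norm_sub_le _ _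
    _ = |k| * |ℓ.im| + 2 * ‖s‖ * |ℓ.re| := by simp
    _ ≤ |k| * ‖ℓ‖ + 2 * ‖s‖ * ‖ℓ‖ := by
        gcongr
        exacts [Complex.abs_im_le_norm ℓ, Complex.abs_re_le_norm ℓ]
    _ = (|k| + 2 * ‖s‖) * ‖ℓ‖ := by ring

theorem norm_exp_sub_one_le_mul_exp (z : ℂ) :
    ‖Complex.exp z - 1‖ ≤ ‖z‖ * Real.exp ‖z‖ := by
  simpa using Complex.norm_exp_sub_sum_le_norm_mul_exp z 1

theorem exists_norm_heckeTerm_one_add_sub_one_le (k : ℤ) (B : ℝ) :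
    ∃ K, 0 ≤ K ∧ ∀ s η : ℂ, ‖s‖ ≤ B → ‖η‖ ≤ 1 / 2 → ‖heckeTerm k s (1 + η) - 1‖ ≤ K * ‖η‖ := by
  set D : ℝ := (|k| + 2 * |B|) * (3 / 2) with hD
  refine ⟨D * Real.exp D, by positivity, fun s η hs hη ↦ ?_⟩
  have hη1 : 1 + η ≠ 0 := fun h ↦ by
    rw [eq_neg_of_add_eq_zero_right h] at hη
    norm_num at hη
  rw [heckeTerm_eq_exp_log k s hη1]
  set X : ℂ := k * ((Complex.log (1 + η)).im * Complex.I) - 2 * s * (Complex.log (1 + η)).re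
  have hX : ‖X‖ ≤ D * ‖η‖ :=
    calc ‖X‖ ≤ (|k| + 2 * ‖s‖) * ‖Complex.log (1 + η)‖ := norm_intCast_mul_I_sub_le k s _
      _ ≤ (|k| + 2 * |B|) * (3 / 2 * ‖η‖) := by
          gcongr
          exacts [hs.trans (le_abs_self B), Complex.norm_log_one_add_half_le_self hη]
      _ = D * ‖η‖ := by rw [hD, mul_assoc]
  calc ‖Complex.exp X - 1‖ ≤ ‖X‖ * Real.exp ‖X‖ := norm_exp_sub_one_le_mul_exp X
    _ ≤ (D * ‖η‖) * Real.exp D := by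
        gcongr
        exact hX.trans (mul_le_of_le_one_right (by positivity) (by linarith))
    _ = D * Real.exp D * ‖η‖ := by ring

theorem exists_norm_heckeTerm_sub_heckeTerm_add_le (k : ℤ) (B : ℝ) :
    ∃ K, 0 ≤ K ∧ ∀ s z w : ℂ, ‖s‖ ≤ B → z ≠ 0 → 2 * ‖w‖ ≤ ‖z‖ →
      ‖heckeTerm k s z - heckeTerm k s (z + w)‖ ≤ ‖heckeTerm k s z‖ * (K * (‖w‖ / ‖z‖)) := by
  obtain ⟨K, hK0, hK⟩ := exists_norm_heckeTerm_one_add_sub_one_le k B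
  refine ⟨K, hK0, fun s z w hs hz hw ↦ ?_⟩
  have hfac : z + w = z * (1 + w / z) := by field_simp
  rw [norm_sub_rev, hfac, map_mul, ← mul_sub_one, norm_mul, ← norm_div]
  gcongr
  refine hK s (w / z) hs ?_
  rw [norm_div, div_le_iff₀ (norm_pos_iff.2 hz)]
  linarith

theorem dirichletSummable_heckeChar (k : ℤ) :
    DirichletSummable (fun ω : GaussianInt ↦ heckeChar k ω) fun ω ↦ logSq ω where
  freq_nonneg := logSq_nonneg
  summable σ hσ := by
    simpa only [heckeTerm_apply, norm_mul_cexp_neg_mul, Complex.ofReal_re] using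
      Summable.of_nonneg_of_le (fun _ ↦ norm_nonneg _)
        (fun ω ↦ norm_heckeTerm_le k (s := σ) le_rfl ω)
        (summable_norm_toComplex_rpow (by linarith : 2 < 2 * σ))

/-- The function `s ↦ ∑ (ω / |ω|) ^ k * |ω| ^ (-2 s)`, summed over the nonzero `ω` in `ℤ[i]`. It
runs over elements rather than ideals, so it is four times the Hecke `L`-function if `4 ∣ k`. -/
noncomputable def heckeL (k : ℤ) : ℂ → ℂ :=
  dirichletSum (fun ω : GaussianInt ↦ heckeChar k ω) fun ω ↦ logSq ω

theorem hasSum_heckeTerm (k : ℤ) {s : ℂ} (hs : 1 < s.re) :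
    HasSum (fun ω : GaussianInt ↦ heckeTerm k s ω) (heckeL k s) :=
  (dirichletSummable_heckeChar k).hasSum hs

theorem bijective_mul_add_out {R : Type*} [CommRing R] [IsDomain R] {α : R} (hα : α ≠ 0) :
    Function.Bijective fun p : (R ⧸ Ideal.span {α}) × R ↦ α * p.2 + p.1.out := by
  have hmk (p : (R ⧸ Ideal.span {α}) × R) :
      Ideal.Quotient.mk (Ideal.span {α}) (α * p.2 + p.1.out) = p.1 := by
    rw [map_add, Ideal.Quotient.eq_zero_iff_mem.2
      (Ideal.mul_mem_right _ _ (Ideal.mem_span_singleton_self α)), zero_add]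
    exact Quotient.out_eq _
  refine ⟨fun p q hpq ↦ ?_, fun x ↦ ?_⟩
  · have hr : p.1 = q.1 := by rw [← hmk p, ← hmk q]; exact congrArg _ hpq
    simp only [hr, add_left_inj, mul_right_inj' hα] at hpq
    exact Prod.ext hr hpq
  · set r := Ideal.Quotient.mk (Ideal.span {α}) x with hr
    obtain ⟨y, hy⟩ := Ideal.mem_span_singleton.1
      (Ideal.Quotient.eq.1 (hr.symm.trans (Quotient.out_eq r).symm))
    exact ⟨(r, y), by simp only [← hy, sub_add_cancel]⟩

/-- The basis `1, i` of `ℤ[i]` over `ℤ`. -/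
noncomputable def gaussianBasis : Module.Basis (Fin 2) ℤ GaussianInt :=
  .ofEquivFun
    { toFun ω := ![ω.re, ω.im]
      invFun v := ⟨v 0, v 1⟩
      map_add' _ _ := by simp
      map_smul' _ _ := by simp
      left_inv _ := rfl
      right_inv v := by ext i; fin_cases i <;> rfl }

theorem leftMulMatrix_gaussianBasis (α : GaussianInt) :
    Algebra.leftMulMatrix gaussianBasis α = !![α.re, -α.im; α.im, α.re] := by
  have hrepr (ω : GaussianInt) (i : Fin 2) : gaussianBasis.repr ω i = ![ω.re, ω.im] i := rfl
  have hbasis (j : Fin 2) : gaussianBasis j = ⟨![1, 0] j, ![0, 1] j⟩ :=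
    gaussianBasis.apply_eq_iff.2 <| by
      ext i
      rw [hrepr]
      fin_cases i <;> fin_cases j <;> simp
  ext i j
  rw [Algebra.leftMulMatrix_eq_repr_mul, hbasis, hrepr]
  fin_cases i <;> fin_cases j <;> simp

theorem card_quotient_span_singleton (α : GaussianInt) :
    Nat.card (GaussianInt ⧸ Ideal.span {α}) = α.norm.natAbs := by
  have := Module.Free.of_basis gaussianBasis
  have := Module.Finite.of_basis gaussianBasis
  rw [← Submodule.cardQuot_apply, ← Ideal.absNorm_apply, Ideal.absNorm_span_singleton,
    Algebra.norm_eq_matrix_det gaussianBasis, leftMulMatrix_gaussianBasis, Matrix.det_fin_two_of,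
    Zsqrtd.norm_def]
  ring_nf

theorem finite_quotient_span_singleton {α : GaussianInt} (hα : α ≠ 0) :
    Finite (GaussianInt ⧸ Ideal.span {α}) :=
  Nat.finite_of_card_ne_zero <| by
    rw [card_quotient_span_singleton]
    exact Int.natAbs_ne_zero.2 (GaussianInt.norm_pos.2 hα).ne'

/-- The comparison `∑ (χ(αω) |αω| ^ (-2 s) - χ(αω + β) |αω + β| ^ (-2 s))` of the Hecke `L`-series
over two residue classes modulo `α`. Cancellation makes it converge on `re s > 1/2`. -/
noncomputable def heckeShiftDiff (k : ℤ) (α β : GaussianInt) (s : ℂ) : ℂ :=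
  ∑' ω : GaussianInt, (heckeTerm k s (α * ω : GaussianInt) -
    heckeTerm k s (α * ω + β : GaussianInt))

theorem sum_heckeShiftDiff (k : ℤ) {α : GaussianInt} (hα : α ≠ 0)
    [Fintype (GaussianInt ⧸ Ideal.span {α})] {s : ℂ} (hs : 1 < s.re) :
    ∑ r : GaussianInt ⧸ Ideal.span {α}, heckeShiftDiff k α r.out s =
      (α.norm * heckeTerm k s α - 1) * heckeL k s := by
  have hsum := hasSum_heckeTerm k hs
  have hall : HasSum (fun p : (GaussianInt ⧸ Ideal.span {α}) × GaussianInt ↦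
      heckeTerm k s (α * p.2 + p.1.out : GaussianInt)) (heckeL k s) :=
    (Equiv.ofBijective _ (bijective_mul_add_out hα)).hasSum_iff
      (f := fun ω : GaussianInt ↦ heckeTerm k s ω) |>.2 hsum
  have hzero : HasSum (fun ω : GaussianInt ↦ heckeTerm k s (α * ω : GaussianInt))
      (heckeTerm k s α * heckeL k s) := by
    simpa only [GaussianInt.toComplex_mul, map_mul] using hsum.mul_left (heckeTerm k s α)
  have hcard : (Fintype.card (GaussianInt ⧸ Ideal.span {α}) : ℂ) = α.norm := by
    rw [← Nat.card_eq_fintype_card, card_quotient_span_singleton, ← Int.cast_natCast,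
      Int.natAbs_of_nonneg (GaussianInt.norm_nonneg α)]
  have hrest : ∑ r : GaussianInt ⧸ Ideal.span {α},
      ∑' ω : GaussianInt, heckeTerm k s (α * ω + r.out : GaussianInt) = heckeL k s := by
    rw [← hall.tsum_eq, hall.summable.tsum_prod, tsum_fintype]
  calc ∑ r : GaussianInt ⧸ Ideal.span {α}, heckeShiftDiff k α r.out s
      = ∑ r : GaussianInt ⧸ Ideal.span {α}, (heckeTerm k s α * heckeL k s -
          ∑' ω : GaussianInt, heckeTerm k s (α * ω + r.out : GaussianInt)) := by
        refine Finset.sum_congr rfl fun r _ ↦ ?_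
        rw [heckeShiftDiff, hzero.summable.tsum_sub (hall.summable.prod_factor r), hzero.tsum_eq]
    _ = (α.norm * heckeTerm k s α - 1) * heckeL k s := by
        rw [Finset.sum_sub_distrib, Finset.sum_const, Finset.card_univ, nsmul_eq_mul, hcard,
          hrest]
        ring

theorem eventually_lt_norm_mul {α : GaussianInt} (hα : α ≠ 0) (ρ : ℝ) :
    ∀ᶠ ω : GaussianInt in cofinite, ρ < ‖((α * ω : GaussianInt) : ℂ)‖ :=
  ((finite_gaussianDisc (ρ ^ 2)).preimage (mul_right_injective₀ hα).injOn).subset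
    fun _ hω ↦ pow_le_pow_left₀ (norm_nonneg _) (not_lt.1 hω) 2

theorem exists_eventually_norm_heckeTerm_sub_le (k : ℤ) {α : GaussianInt} (hα : α ≠ 0)
    (β : GaussianInt) (σ B : ℝ) :
    ∃ C, ∀ᶠ ω : GaussianInt in cofinite, ∀ s : ℂ, σ ≤ s.re → ‖s‖ ≤ B →
      ‖heckeTerm k s (α * ω : GaussianInt) - heckeTerm k s (α * ω + β : GaussianInt)‖ ≤
        C * ‖((α * ω : GaussianInt) : ℂ)‖ ^ (-(2 * σ + 1)) := by
  obtain ⟨K, hK0, hK⟩ := exists_norm_heckeTerm_sub_heckeTerm_add_le k B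
  refine ⟨K * ‖(β : ℂ)‖, ?_⟩
  filter_upwards [eventually_lt_norm_mul hα (2 * ‖(β : ℂ)‖)] with ω hω s hs hsB
  set z : ℂ := ((α * ω : GaussianInt) : ℂ) with hz
  have hpos : 0 < ‖z‖ := (mul_nonneg two_pos.le (norm_nonneg _)).trans_lt hω
  rw [GaussianInt.toComplex_add, ← hz]
  calc ‖heckeTerm k s z - heckeTerm k s (z + β)‖
      ≤ ‖heckeTerm k s z‖ * (K * (‖(β : ℂ)‖ / ‖z‖)) :=
        hK s z β hsB (norm_pos_iff.1 hpos) hω.le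
    _ ≤ ‖z‖ ^ (-(2 * σ)) * (K * (‖(β : ℂ)‖ / ‖z‖)) := by
        gcongr
        exact norm_heckeTerm_le k hs _
    _ = K * ‖(β : ℂ)‖ * ‖z‖ ^ (-(2 * σ + 1)) := by
        rw [neg_add, Real.rpow_add hpos, Real.rpow_neg_one]
        ring

theorem analyticAt_heckeShiftDiff (k : ℤ) {α : GaussianInt} (hα : α ≠ 0) (β : GaussianInt) {s₀ : ℂ}
    (hs₀ : 1 / 2 < s₀.re) : AnalyticAt ℂ (heckeShiftDiff k α β) s₀ := by
  obtain ⟨σ, hσ, hσs₀⟩ := exists_between hs₀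
  have hUo : IsOpen ({s : ℂ | σ < s.re} ∩ Metric.ball 0 (‖s₀‖ + 1)) :=
    (isOpen_lt_re σ).inter Metric.isOpen_ball
  obtain ⟨C, hC⟩ := exists_eventually_norm_heckeTerm_sub_le k hα β σ (‖s₀‖ + 1)
  have hsum := ((summable_norm_toComplex_rpow (by linarith : 2 < 2 * σ + 1)).comp_injective
    (mul_right_injective₀ hα)).mul_left C
  have hunif := tendstoUniformlyOn_tsum_of_cofinite_eventually hsum <| hC.mono fun _ hω s
    (hs : s ∈ {s : ℂ | σ < s.re} ∩ Metric.ball 0 (‖s₀‖ + 1)) ↦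
      hω s hs.1.le (mem_ball_zero_iff.1 hs.2).le
  exact (hunif.tendstoLocallyUniformlyOn.differentiableOn (.of_forall fun _ ↦
    (Differentiable.fun_sum fun _ _ ↦ (differentiable_heckeTerm k _).sub
      (differentiable_heckeTerm k _)).differentiableOn) hUo).analyticAt
    (hUo.mem_nhds ⟨hσs₀, by simp⟩)

/-- The four units of `ℤ[i]`. -/
def gaussianUnits : Finset GaussianInt := {1, -1, ⟨0, 1⟩, ⟨0, -1⟩}

theorem pow_four_of_mem_gaussianUnits : ∀ u ∈ gaussianUnits, u ^ 4 = 1 := by decide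

theorem mem_gaussianUnits {u : GaussianInt} : u ∈ gaussianUnits ↔ IsUnit u := by
  constructor
  · exact fun hu ↦ .of_pow_eq_one (pow_four_of_mem_gaussianUnits u hu) four_ne_zero
  · intro hu
    obtain ⟨a, b⟩ := u
    have hab := (Zsqrtd.norm_eq_one_iff' (by norm_num) _).2 hu
    simp only [Zsqrtd.norm_def] at hab
    have ha : -1 ≤ a ∧ a ≤ 1 := by constructor <;> nlinarith [mul_self_nonneg b]
    have hb : -1 ≤ b ∧ b ≤ 1 := by constructor <;> nlinarith [mul_self_nonneg a]
    obtain ⟨ha₁, ha₂⟩ := ha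
    obtain ⟨hb₁, hb₂⟩ := hb
    interval_cases a <;> interval_cases b <;> first | omega | decide

theorem card_gaussianUnits : gaussianUnits.card = 4 := by decide

theorem heckeChar_of_isUnit (h : ℤ) {u : GaussianInt} (hu : IsUnit u) :
    heckeChar (4 * h) u = 1 := by
  have hnorm := norm_toComplex_eq_one_iff.2 hu
  have hpow : (u : ℂ) ^ (4 : ℤ) = 1 := by
    rw [zpow_ofNat, ← map_pow, pow_four_of_mem_gaussianUnits u (mem_gaussianUnits.2 hu), map_one]
  rw [heckeChar_of_ne_zero _ (norm_ne_zero_iff.1 (hnorm ▸ one_ne_zero)), hnorm, Complex.ofReal_one,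
    div_one, zpow_mul, hpow, one_zpow]

theorem logSq_eq_zero_iff {ω : GaussianInt} : logSq ω = 0 ↔ ω = 0 ∨ IsUnit ω := by
  rw [logSq, ← norm_toComplex_eq_one_iff, mul_eq_zero_iff_left two_ne_zero, Real.log_eq_zero,
    norm_eq_zero, GaussianInt.toComplex_eq_zero]
  have := norm_nonneg (ω : ℂ)
  grind

theorem tsum_heckeChar_logSq_eq_zero_ne_zero (h : ℤ) :
    ∑' ω : GaussianInt, (if logSq ω = 0 then heckeChar (4 * h) ω else 0) ≠ 0 := by
  have hterm (u : GaussianInt) (hu : u ∈ gaussianUnits) :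
      (if logSq u = 0 then heckeChar (4 * h) u else 0) = 1 := by
    have hu' := mem_gaussianUnits.1 hu
    rw [if_pos (logSq_eq_zero_iff.2 (.inr hu')), heckeChar_of_isUnit h hu']
  rw [tsum_eq_sum (s := gaussianUnits), Finset.sum_congr rfl hterm]
  · simp [card_gaussianUnits]
  · intro ω hω
    rw [mem_gaussianUnits] at hω
    by_cases h0 : ω = 0 <;> simp [logSq_eq_zero_iff, hω, h0]

theorem exists_hasOrderWithinAt_heckeL (h : ℤ) {s₀ : ℂ} (hs₀ : s₀.re = 1) {α : GaussianInt}
    (hα : α ≠ 0) {m : ℕ}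
    (hm : analyticOrderAt (fun s ↦ α.norm * heckeTerm (4 * h) s α - 1) s₀ = m) :
    ∃ n : ℕ, HasOrderWithinAt (heckeL (4 * h)) {s | 1 < s.re} s₀ (n - m) := by
  have := finite_quotient_span_singleton hα
  have := Fintype.ofFinite (GaussianInt ⧸ Ideal.span {α})
  refine exists_hasOrderWithinAt_of_eq_mul (by simp [hs₀])
    (Finset.analyticAt_fun_sum _ fun r _ ↦
      analyticAt_heckeShiftDiff (4 * h) hα r.out (by rw [hs₀]; norm_num))
    ?_ hm (fun s hs ↦ sum_heckeShiftDiff (4 * h) hα hs)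
    ((dirichletSummable_heckeChar _).not_eventually_dirichletSum_eq_zero
      (tsum_heckeChar_logSq_eq_zero_ne_zero h) hs₀.ge)
  have hdiff := differentiable_heckeTerm (4 * h) α
  exact Differentiable.analyticAt (by fun_prop) s₀

theorem eq_zero_of_eventually_exp_mul_I_eq_one {ι : Type*} {l : Filter ι} [l.NeBot] {c : ℝ}
    {x : ι → ℝ} (hx : Tendsto x l (𝓝[≠] 0))
    (hexp : ∀ᶠ i in l, Complex.exp ((c * x i : ℝ) * Complex.I) = 1) : c = 0 := by
  have hderiv :
      HasDerivAt (fun y : ℝ ↦ Complex.exp ((c * y : ℝ) * Complex.I)) (c * Complex.I) 0 := by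
    simpa using ((((hasDerivAt_id (0 : ℝ)).const_mul c).ofReal_comp).mul_const Complex.I).cexp
  have hslope := hderiv.tendsto_slope.comp hx
  have hzero : (c : ℂ) * Complex.I = 0 := by
    refine tendsto_nhds_unique hslope (tendsto_const_nhds.congr' ?_)
    filter_upwards [hexp] with i hi
    simp only [Function.comp_apply, slope_def_module, hi]
    simp
  simpa using hzero

theorem tendsto_log_succ_sub_log_nhdsNE :
    Tendsto (fun n : ℕ ↦ Real.log (n + 1) - Real.log n) atTop (𝓝[≠] 0) := by
  refine tendsto_nhdsWithin_iff.2 ⟨Real.tendsto_log_nat_add_one_sub_log, ?_⟩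
  filter_upwards [eventually_gt_atTop 0] with n hn
  have hn' : (0 : ℝ) < n := by exact_mod_cast hn
  exact sub_ne_zero.2 (Real.log_lt_log hn' (lt_add_one _)).ne'

theorem tendsto_arg_natCast_add_I_nhdsNE :
    Tendsto (fun n : ℕ ↦ (n + Complex.I).arg) atTop (𝓝[≠] 0) := by
  refine tendsto_nhdsWithin_iff.2 ⟨?_, .of_forall fun n ↦ by simp [Complex.arg_eq_zero_iff]⟩
  have hlim : Tendsto (fun n : ℕ ↦ (1 + Complex.I * (n : ℂ)⁻¹).arg) atTop (𝓝 0) := by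
    have h1 : Tendsto (fun n : ℕ ↦ 1 + Complex.I * (n : ℂ)⁻¹) atTop (𝓝 1) := by
      simpa using (tendsto_inv_atTop_nhds_zero_nat (𝕜 := ℂ)).const_mul Complex.I |>.const_add 1
    simpa [Function.comp_def] using
      (Complex.continuousAt_arg Complex.one_mem_slitPlane).tendsto.comp h1
  refine hlim.congr' ?_
  filter_upwards [eventually_gt_atTop 0] with n hn
  have hn' : (0 : ℝ) < n := by exact_mod_cast hn
  rw [← Complex.arg_real_mul _ hn', Complex.ofReal_natCast, mul_add, mul_one, mul_left_comm,
    mul_inv_cancel₀ (by exact_mod_cast hn.ne'), mul_one]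

theorem heckeTerm_mul_I (k : ℤ) (t : ℝ) {z : ℂ} (hz : z ≠ 0) :
    heckeTerm k (t * Complex.I) z =
      Complex.exp ((k * z.arg - 2 * t * Real.log ‖z‖ : ℝ) * Complex.I) := by
  rw [heckeTerm_eq_exp_log k _ hz, Complex.log_im, Complex.log_re]
  push_cast
  ring_nf

theorem norm_mul_heckeTerm_one_add (k : ℤ) (s : ℂ) {α : GaussianInt} (hα : α ≠ 0) :
    α.norm * heckeTerm k (1 + s) α = heckeTerm k s α := by
  have hα' : (α : ℂ) ≠ 0 := by simpa using hα
  have hexp : (Complex.exp (logSq α) : ℂ) = α.norm := by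
    rw [← Complex.ofReal_exp, ← one_mul (logSq α), exp_mul_logSq hα', mul_one, Real.rpow_two,
      ← Complex.normSq_eq_norm_sq, GaussianInt.intCast_complex_norm]
  rw [heckeTerm_apply, heckeTerm_apply, ← hexp, mul_left_comm, ← Complex.exp_add]
  ring_nf

theorem eq_zero_of_heckeTerm_mul_I_eq_one {k : ℤ} {t : ℝ}
    (hall : ∀ α : GaussianInt, α ≠ 0 → heckeTerm k (t * Complex.I) α = 1) : k = 0 ∧ t = 0 := by
  have ht : t = 0 := by
    suffices -2 * t = 0 by simpa
    refine eq_zero_of_eventually_exp_mul_I_eq_one tendsto_log_succ_sub_log_nhdsNE ?_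
    have hnat (n : ℕ) (hn : n ≠ 0) :
        Complex.exp ((-(2 * t * Real.log n) : ℝ) * Complex.I) = 1 := by
      have hn' : (n : ℂ) ≠ 0 := by exact_mod_cast hn
      have := hall n (by exact_mod_cast hn)
      rwa [map_natCast, heckeTerm_mul_I k t hn', Complex.natCast_arg, Complex.norm_natCast,
        mul_zero, zero_sub] at this
    filter_upwards [eventually_ne_atTop 0] with n hn
    have hdiv : ((-2 * t * (Real.log (n + 1) - Real.log n) : ℝ) : ℂ) * Complex.I =
        (-(2 * t * Real.log (n + 1 : ℕ)) : ℝ) * Complex.I -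
          (-(2 * t * Real.log n) : ℝ) * Complex.I := by
      push_cast
      ring
    rw [hdiv, Complex.exp_sub, hnat n hn, hnat (n + 1) n.succ_ne_zero, div_one]
  refine ⟨?_, ht⟩
  suffices (k : ℝ) = 0 by exact_mod_cast this
  refine eq_zero_of_eventually_exp_mul_I_eq_one tendsto_arg_natCast_add_I_nhdsNE
    (.of_forall fun n ↦ ?_)
  have hn : (n + Complex.I : ℂ) ≠ 0 := fun h ↦ by simpa using congrArg Complex.im h
  have := hall ⟨n, 1⟩ (by simp [Zsqrtd.ext_iff])
  rwa [GaussianInt.toComplex_def', Int.cast_natCast, Int.cast_one, one_mul, heckeTerm_mul_I k t hn,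
    ht, mul_zero, zero_mul, sub_zero] at this

theorem exists_hasOrderWithinAt_heckeL_natCast {h : ℤ} {t : ℝ} (hne : (h, t) ≠ (0, 0)) :
    ∃ n : ℕ, HasOrderWithinAt (heckeL (4 * h)) {s | 1 < s.re} (1 + t * Complex.I) n := by
  obtain ⟨α, hα, hterm⟩ : ∃ α : GaussianInt, α ≠ 0 ∧ heckeTerm (4 * h) (t * Complex.I) α ≠ 1 := by
    by_contra! hall
    obtain ⟨hk, ht⟩ := eq_zero_of_heckeTerm_mul_I_eq_one hall
    exact hne (Prod.ext ((mul_eq_zero_iff_left four_ne_zero).1 hk) ht)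
  have hdiff := differentiable_heckeTerm (4 * h) α
  obtain ⟨n, hn⟩ := exists_hasOrderWithinAt_heckeL h (s₀ := 1 + t * Complex.I) (by simp) hα (m := 0)
    ((Differentiable.analyticAt (by fun_prop) _).analyticOrderAt_eq_zero.2 <| by
      rwa [norm_mul_heckeTerm_one_add _ _ hα, sub_ne_zero])
  exact ⟨n, by simpa using hn⟩

theorem not_eventually_norm_heckeL_zero_le (C : ℝ) :
    ¬ ∀ᶠ s in 𝓝[{s | 1 < s.re}] 1, ‖heckeL 0 s‖ ≤ C := by
  intro hC
  have hsum := (dirichletSummable_heckeChar 0).summable_of_eventually_norm_le (fun ω ↦ ?_) hC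
  · refine not_summable_inv_sq_norm_toComplex (hsum.congr fun ω ↦ ?_)
    rcases eq_or_ne ω 0 with rfl | hω
    · simp
    have hω' : (ω : ℂ) ≠ 0 := by simpa using hω
    rw [norm_heckeChar 0 hω', one_mul, ← neg_one_mul, exp_mul_logSq hω', mul_neg_one,
      Real.rpow_neg (norm_nonneg _), Real.rpow_two]
  · rcases eq_or_ne (ω : ℂ) 0 with hω | hω
    · simp [hω]
    · simp [heckeChar_of_ne_zero 0 hω]

theorem analyticOrderAt_norm_mul_heckeTerm_sub_one {k : ℤ} {α : GaussianInt} (hα : α ≠ 0)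
    (hunit : ¬ IsUnit α) (hk : heckeChar k α = 1) :
    analyticOrderAt (fun s ↦ α.norm * heckeTerm k s α - 1) 1 = 1 := by
  have hone : α.norm * heckeTerm k 1 α = 1 := by
    simpa [heckeTerm_apply, hk] using norm_mul_heckeTerm_one_add k 0 hα
  have hderiv : HasDerivAt (fun s ↦ α.norm * heckeTerm k s α - 1) (-logSq α) 1 := by
    have hexp := (((hasDerivAt_id' (1 : ℂ)).fun_neg.mul_const (logSq α : ℂ)).cexp.const_mul
      (α.norm * heckeChar k α)).sub_const 1
    refine (hexp.congr_deriv ?_).congr_of_eventuallyEq (.of_forall fun s ↦ ?_)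
    · rw [← mul_assoc, mul_assoc (α.norm : ℂ), ← heckeTerm_apply, hone]
      ring
    · simp only [heckeTerm_apply, mul_assoc]
  have hdiff := differentiable_heckeTerm k α
  refine AnalyticAt.analyticOrderAt_eq_one_of_zero_deriv_ne_zero
    (Differentiable.analyticAt (by fun_prop) 1) (by rw [hone, sub_self]) ?_
  rw [hderiv.deriv, neg_ne_zero, Complex.ofReal_ne_zero]
  exact fun hlog ↦ (logSq_eq_zero_iff.1 hlog).elim hα hunit

theorem hasOrderWithinAt_heckeL_zero_one : HasOrderWithinAt (heckeL 0) {s | 1 < s.re} 1 (-1) := by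
  have htwo : (2 : GaussianInt) ≠ 0 := two_ne_zero
  have hunit : ¬ IsUnit (2 : GaussianInt) := by
    rw [← norm_toComplex_eq_one_iff, map_ofNat]
    norm_num
  have hchar : heckeChar (4 * 0) (2 : GaussianInt) = 1 := by
    simp [heckeChar_of_ne_zero]
  obtain ⟨n, hn⟩ := exists_hasOrderWithinAt_heckeL 0 Complex.one_re htwo
    (analyticOrderAt_norm_mul_heckeTerm_sub_one htwo hunit hchar)
  rw [mul_zero] at hn
  have hlt : (n : ℤ) - 1 < 0 := by
    by_contra! hn₀
    obtain ⟨C, hC⟩ := hn.exists_eventually_norm_le (by simp) hn₀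
    exact not_eventually_norm_heckeL_zero_le C hC
  obtain rfl : n = 0 := by omega
  simpa using hn

/-! ### The generalized Mangoldt function -/

theorem norm_toComplex_le_of_dvd {d ω : GaussianInt} (hω : ω ≠ 0) (h : d ∣ ω) :
    ‖(d : ℂ)‖ ≤ ‖(ω : ℂ)‖ := by
  obtain ⟨e, rfl⟩ := h
  rw [GaussianInt.toComplex_mul, norm_mul]
  exact le_mul_of_one_le_right (norm_nonneg _) (one_le_norm_toComplex (right_ne_zero_of_mul hω))

theorem IsUnitMulPrimePow.dvd {p ω : GaussianInt} (h : IsUnitMulPrimePow p ω) : p ∣ ω := by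
  obtain ⟨-, u, -, n, hn, rfl⟩ := h
  exact (dvd_pow_self p (Nat.one_le_iff_ne_zero.1 hn)).mul_left u

theorem gaussianMangoldt_zero : gaussianMangoldt 0 = 0 := by
  refine gaussianMangoldt_eq_zero ?_
  rintro ⟨p, hp, u, hu, n, -, h⟩
  exact mul_ne_zero hu.ne_zero (pow_ne_zero n hp.ne_zero) h.symm

theorem gaussianMangoldt_of_isUnit {u : GaussianInt} (hu : IsUnit u) : gaussianMangoldt u = 0 :=
  gaussianMangoldt_eq_zero fun ⟨_, hp⟩ ↦ hp.1.not_isUnit (isUnit_of_dvd_unit hp.dvd hu)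

theorem gaussianMangoldt_nonneg (ω : GaussianInt) : 0 ≤ gaussianMangoldt ω := by
  by_cases h : ∃ p, IsUnitMulPrimePow p ω
  · obtain ⟨p, hp⟩ := h
    rw [gaussianMangoldt_eq_log hp]
    exact Real.log_nonneg (one_le_norm_toComplex hp.1.ne_zero)
  · rw [gaussianMangoldt_eq_zero h]

theorem gaussianMangoldt_le_log (ω : GaussianInt) : gaussianMangoldt ω ≤ Real.log ‖(ω : ℂ)‖ := by
  rcases eq_or_ne ω 0 with rfl | hω
  · simp [gaussianMangoldt_zero]
  by_cases h : ∃ p, IsUnitMulPrimePow p ω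
  · obtain ⟨p, hp⟩ := h
    rw [gaussianMangoldt_eq_log hp]
    exact Real.log_le_log (one_pos.trans_le (one_le_norm_toComplex hp.1.ne_zero))
      (norm_toComplex_le_of_dvd hω hp.dvd)
  · rw [gaussianMangoldt_eq_zero h]
    exact Real.log_nonneg (one_le_norm_toComplex hω)

open Classical in
/-- The divisors of a nonzero Gaussian integer, including all associates. -/
noncomputable def gaussianDivisors (ω : GaussianInt) : Finset GaussianInt :=
  {d ∈ gaussianDisc (‖(ω : ℂ)‖ ^ 2) | d ∣ ω}

theorem mem_gaussianDivisors {d ω : GaussianInt} (hω : ω ≠ 0) :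
    d ∈ gaussianDivisors ω ↔ d ∣ ω := by
  classical
  rw [gaussianDivisors, Finset.mem_filter, mem_gaussianDisc, and_iff_right_iff_imp]
  exact fun h ↦ pow_le_pow_left₀ (norm_nonneg _) (norm_toComplex_le_of_dvd hω h) 2

theorem associated_pow_multiplicity_add_one {M : Type*} [CommMonoidWithZero M]
    [IsCancelMulZero M] [WfDvdMonoid M] {p q a : M} (hp : Prime p) (hq : Prime q) (ha : a ≠ 0)
    {m : ℕ} (hdvd : q ^ m ∣ p * a) (hnot : ¬ q ^ m ∣ a) :
    Associated (p ^ (multiplicity p a + 1)) (q ^ m) := by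
  have hqp : q ∣ p := by
    by_contra hqp
    exact hnot (hq.pow_dvd_of_dvd_mul_left m hqp hdvd)
  have hassoc : Associated (p ^ m) (q ^ m) :=
    ((hq.dvd_prime_iff_associated hp).1 hqp).symm.pow_pow
  rw [← hassoc.dvd_iff_dvd_left] at hdvd hnot
  have hfin : FiniteMultiplicity p a := .of_prime_left hp ha
  have hmul : emultiplicity p (p * a) = (multiplicity p a + 1 : ℕ) := by
    rw [emultiplicity_mul hp, hfin.emultiplicity_eq_multiplicity,
      FiniteMultiplicity.emultiplicity_self (.of_prime_left hp hp.ne_zero), add_comm]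
    rfl
  rw [pow_dvd_iff_le_emultiplicity] at hdvd hnot
  rw [hmul, Nat.cast_le] at hdvd
  rw [hfin.emultiplicity_eq_multiplicity, Nat.cast_le, not_le] at hnot
  rwa [← le_antisymm hdvd hnot]

theorem sum_gaussianMangoldt_new_divisors {p a : GaussianInt} (hp : Prime p) (ha : a ≠ 0) :
    ∑ d ∈ gaussianDivisors (p * a) \ gaussianDivisors a, gaussianMangoldt d =
      4 * Real.log ‖(p : ℂ)‖ := by
  set n := multiplicity p a
  have hpa : p * a ≠ 0 := mul_ne_zero hp.ne_zero ha
  have hfin : FiniteMultiplicity p a := .of_prime_left hp ha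
  have hsub : gaussianUnits.image (· * p ^ (n + 1)) ⊆
      gaussianDivisors (p * a) \ gaussianDivisors a := by
    intro d hd
    obtain ⟨u, hu, rfl⟩ := Finset.mem_image.1 hd
    rw [mem_gaussianUnits] at hu
    rw [Finset.mem_sdiff, mem_gaussianDivisors hpa, mem_gaussianDivisors ha, hu.mul_left_dvd,
      hu.mul_left_dvd, pow_succ']
    exact ⟨mul_dvd_mul_left p (pow_multiplicity_dvd p a),
      pow_succ' p n ▸ hfin.not_pow_dvd_of_multiplicity_lt n.lt_succ_self⟩
  rw [← Finset.sum_subset hsub fun d hd hdn ↦ gaussianMangoldt_eq_zero ?_, Finset.sum_image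
    (mul_left_injective₀ (pow_ne_zero _ hp.ne_zero)).injOn]
  · have hlog (u : GaussianInt) (hu : u ∈ gaussianUnits) :
        gaussianMangoldt (u * p ^ (n + 1)) = Real.log ‖(p : ℂ)‖ :=
      gaussianMangoldt_eq_log ⟨hp, u, mem_gaussianUnits.1 hu, n + 1, n.succ_pos, rfl⟩
    rw [Finset.sum_congr rfl hlog, Finset.sum_const, card_gaussianUnits, nsmul_eq_mul,
      Nat.cast_ofNat]
  · rintro ⟨q, hq, u, hu, m, -, rfl⟩
    rw [Finset.mem_sdiff, mem_gaussianDivisors hpa, mem_gaussianDivisors ha, hu.mul_left_dvd,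
      hu.mul_left_dvd] at hd
    obtain ⟨w, hw⟩ := associated_pow_multiplicity_add_one hp hq ha hd.1 hd.2
    refine hdn (Finset.mem_image.2 ⟨u * w, mem_gaussianUnits.2 (hu.mul w.isUnit), ?_⟩)
    rw [← hw]
    ring

theorem sum_gaussianMangoldt_divisors {ω : GaussianInt} (hω : ω ≠ 0) :
    ∑ d ∈ gaussianDivisors ω, gaussianMangoldt d = 2 * logSq ω := by
  induction ω using UniqueFactorizationMonoid.induction_on_prime with
  | h₁ => exact absurd rfl hω
  | h₂ u hu =>
    rw [logSq_eq_zero_iff.2 (.inr hu), mul_zero]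
    exact Finset.sum_eq_zero fun d hd ↦
      gaussianMangoldt_of_isUnit (isUnit_of_dvd_unit ((mem_gaussianDivisors hω).1 hd) hu)
  | h₃ a p ha hp ih =>
    have hsub : gaussianDivisors a ⊆ gaussianDivisors (p * a) := fun d hd ↦
      (mem_gaussianDivisors hω).2 (((mem_gaussianDivisors ha).1 hd).mul_left p)
    rw [← Finset.sum_sdiff hsub, ih ha, sum_gaussianMangoldt_new_divisors hp ha,
      GaussianInt.toComplex_mul, logSq_mul (by simpa using hp.ne_zero) (by simpa using ha)]
    simp only [logSq]
    ring

theorem tsum_fiber_mul_fst {M : Type*} [AddCommMonoid M] [TopologicalSpace M]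
    (f : GaussianInt → M) {ω : GaussianInt} (hω : ω ≠ 0) :
    ∑' p : (fun p : GaussianInt × GaussianInt ↦ p.1 * p.2) ⁻¹' {ω}, f p.1.1 =
      ∑ d ∈ gaussianDivisors ω, f d := by
  rw [← Finset.tsum_subtype]
  refine (Equiv.ofBijective
    (fun p : (fun p : GaussianInt × GaussianInt ↦ p.1 * p.2) ⁻¹' {ω} ↦
      (⟨p.1.1, (mem_gaussianDivisors hω).2 ⟨p.1.2, p.2.symm⟩⟩ : gaussianDivisors ω))
    ⟨fun p q hpq ↦ ?_, fun ⟨d, hd⟩ ↦ ?_⟩).tsum_eq fun d : gaussianDivisors ω ↦ f d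
  · have hp : p.1.1 * p.1.2 = ω := p.2
    have hq : q.1.1 * q.1.2 = ω := q.2
    have hfst : p.1.1 = q.1.1 := congrArg Subtype.val hpq
    have hne : p.1.1 ≠ 0 := left_ne_zero_of_mul (hp ▸ hω)
    exact Subtype.ext (Prod.ext hfst (mul_left_cancel₀ hne (hp.trans (hfst ▸ hq.symm))))
  · obtain ⟨e, he⟩ := (mem_gaussianDivisors hω).1 hd
    exact ⟨⟨(d, e), he.symm⟩, rfl⟩

theorem dirichletSummable_gaussianMangoldt :
    DirichletSummable gaussianMangoldt fun ω : GaussianInt ↦ logSq ω := by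
  refine (dirichletSummable_heckeChar 0).freq_mul.of_norm_le (C := 1) fun ω ↦ ?_
  rcases eq_or_ne ω 0 with rfl | hω
  · simp [gaussianMangoldt_zero]
  have hlog := gaussianMangoldt_le_log ω
  rw [norm_mul, norm_heckeChar 0 (by simpa using hω), Complex.norm_real, one_mul, mul_one,
    Real.norm_of_nonneg (gaussianMangoldt_nonneg ω), Real.norm_of_nonneg (logSq_nonneg ω)]
  have := logSq_nonneg ω
  rw [logSq] at this ⊢
  linarith

theorem norm_gaussianMangoldt_mul_heckeChar_le (k : ℤ) (ω : GaussianInt) :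
    ‖(gaussianMangoldt ω * heckeChar k ω : ℂ)‖ ≤ gaussianMangoldt ω := by
  rw [norm_mul, Complex.norm_real, Real.norm_of_nonneg (gaussianMangoldt_nonneg ω)]
  exact mul_le_of_le_one_right (gaussianMangoldt_nonneg ω) (norm_heckeChar_le_one k ω)

theorem dirichletSummable_gaussianMangoldt_mul_heckeChar (k : ℤ) :
    DirichletSummable (fun ω : GaussianInt ↦ (gaussianMangoldt ω * heckeChar k ω : ℂ))
      fun ω ↦ logSq ω :=
  dirichletSummable_gaussianMangoldt.of_norm_le (C := 1) fun ω ↦ by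
    rw [one_mul, Real.norm_of_nonneg (gaussianMangoldt_nonneg ω)]
    exact norm_gaussianMangoldt_mul_heckeChar_le k ω

/-- The Dirichlet series of the generalized Mangoldt function twisted by `heckeChar k`. -/
noncomputable def heckeMangoldt (k : ℤ) : ℂ → ℂ :=
  dirichletSum (fun ω : GaussianInt ↦ gaussianMangoldt ω * heckeChar k ω) fun ω ↦ logSq ω

theorem heckeMangoldt_mul_heckeL (k : ℤ) {s : ℂ} (hs : 1 < s.re) :
    heckeMangoldt k s * heckeL k s = -2 * deriv (heckeL k) s := by
  have hΛ := (dirichletSummable_gaussianMangoldt_mul_heckeChar k).summable_norm hs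
  have hL := (dirichletSummable_heckeChar k).summable_norm hs
  have hfib := (summable_mul_of_summable_norm hΛ hL).hasSum.tsum_fiberwise
    fun p : GaussianInt × GaussianInt ↦ p.1 * p.2
  have hderiv : deriv (heckeL k) s = _ := ((dirichletSummable_heckeChar k).hasDerivAt hs).deriv
  rw [heckeMangoldt, heckeL, dirichletSum, dirichletSum, tsum_mul_tsum_of_summable_norm hΛ hL,
    ← hfib.tsum_eq, ← heckeL, hderiv, neg_mul_neg, dirichletSum, ← tsum_mul_left]
  refine tsum_congr fun ω ↦ ?_
  have hterm (p : (fun p : GaussianInt × GaussianInt ↦ p.1 * p.2) ⁻¹' {ω}) :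
      (gaussianMangoldt p.1.1 * heckeChar k p.1.1 * Complex.exp (-s * logSq p.1.1)) *
        (heckeChar k p.1.2 * Complex.exp (-s * logSq p.1.2)) =
      gaussianMangoldt p.1.1 * heckeTerm k s ω := by
    have hp : p.1.1 * p.1.2 = ω := p.2
    rw [mul_assoc (gaussianMangoldt p.1.1 : ℂ), ← heckeTerm_apply, ← heckeTerm_apply, mul_assoc,
      ← map_mul, ← map_mul, hp]
  simp only [hterm]
  rw [tsum_mul_right, ← Complex.ofReal_tsum, mul_assoc (logSq ω : ℂ), ← heckeTerm_apply]
  rcases eq_or_ne ω 0 with rfl | hω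
  · simp
  · rw [tsum_fiber_mul_fst _ hω, sum_gaussianMangoldt_divisors hω]
    push_cast
    ring

/-! ### Non-vanishing on the line `re s = 1` -/

theorem HasOrderWithinAt.exists_heckeMangoldt_eq {k n : ℤ} {s₀ : ℂ} (hs₀ : s₀.re = 1)
    (h : HasOrderWithinAt (heckeL k) {s | 1 < s.re} s₀ n) :
    ∃ φ : ℂ → ℂ, ContinuousAt φ s₀ ∧
      ∀ᶠ s in 𝓝[{s | 1 < s.re}] s₀, heckeMangoldt k s = (-2 * n : ℝ) / (s - s₀) + φ s := by
  obtain ⟨φ, hφ, hev⟩ := h.exists_logDeriv_eq (isOpen_lt_re 1) (by simp [hs₀])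
  refine ⟨fun s ↦ -2 * φ s, hφ.const_mul _, ?_⟩
  filter_upwards [hev, self_mem_nhdsWithin] with s ⟨hne, hlog⟩ hs
  have hlogDeriv : heckeMangoldt k s = -2 * logDeriv (heckeL k) s := by
    rw [logDeriv_apply, ← mul_div_assoc, eq_div_iff hne, heckeMangoldt_mul_heckeL k hs]
  rw [hlogDeriv, hlog]
  push_cast
  ring

theorem heckeTerm_add (k l : ℤ) (s w z : ℂ) :
    heckeTerm (k + l) (s + w) z = heckeTerm k s z * heckeTerm l w z := by
  rcases eq_or_ne z 0 with rfl | hz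
  · simp
  · rw [heckeTerm_eq_exp_log _ _ hz, heckeTerm_eq_exp_log _ _ hz, heckeTerm_eq_exp_log _ _ hz,
      ← Complex.exp_add]
    push_cast
    ring_nf

theorem heckeTerm_zero_ofReal (σ : ℝ) (z : ℂ) :
    heckeTerm 0 σ z = ‖heckeTerm 0 σ z‖ := by
  rcases eq_or_ne z 0 with rfl | hz
  · simp
  · rw [heckeTerm_apply, heckeChar_of_ne_zero 0 hz, zpow_zero, one_mul, ← Complex.ofReal_neg,
      ← Complex.ofReal_mul, ← Complex.ofReal_exp, Complex.norm_real, Real.norm_eq_abs,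
      Real.abs_exp]

theorem three_add_four_mul_re_add_re_sq_nonneg {z : ℂ} (hz : ‖z‖ = 1) :
    0 ≤ 3 + 4 * z.re + (z ^ 2).re := by
  have hsq : z.re ^ 2 + z.im ^ 2 = 1 := by
    rw [← one_pow 2, ← hz, Complex.sq_norm, Complex.normSq_apply, sq, sq]
  calc 0 ≤ 2 * (1 + z.re) ^ 2 := by positivity
    _ = 3 + 4 * z.re + (z ^ 2).re := by
      rw [sq z, Complex.mul_re]
      linear_combination hsq

theorem hasSum_re_heckeMangoldt (k : ℤ) {s : ℂ} (hs : 1 < s.re) :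
    HasSum (fun ω : GaussianInt ↦ gaussianMangoldt ω * (heckeTerm k s ω).re)
      (heckeMangoldt k s).re := by
  simpa only [heckeMangoldt, mul_assoc, ← heckeTerm_apply, Complex.re_ofReal_mul] using
    Complex.hasSum_re ((dirichletSummable_gaussianMangoldt_mul_heckeChar k).hasSum hs)

theorem heckeMangoldt_three_four_one (k : ℤ) (t : ℝ) {ε : ℝ} (hε : 0 < ε) :
    0 ≤ 3 * (heckeMangoldt 0 (1 + ε)).re + 4 * (heckeMangoldt k (1 + t * Complex.I + ε)).re +
      (heckeMangoldt (2 * k) (1 + (2 * t : ℝ) * Complex.I + ε)).re := by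
  refine HasSum.nonneg (fun ω ↦ ?_) ((((hasSum_re_heckeMangoldt 0 ?_).mul_left 3).add
    ((hasSum_re_heckeMangoldt k ?_).mul_left 4)).add (hasSum_re_heckeMangoldt (2 * k) ?_))
  · rcases eq_or_ne ω 0 with rfl | hω
    · simp
    set z := heckeTerm k (t * Complex.I) ω
    have hz : ‖z‖ = 1 := by simp [z, norm_heckeTerm k _ (show (ω : ℂ) ≠ 0 by simpa using hω)]
    set r := ‖heckeTerm 0 ((1 + ε : ℝ) : ℂ) ω‖
    have hr : heckeTerm 0 (1 + ε) ω = r := by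
      rw [← heckeTerm_zero_ofReal, Complex.ofReal_add, Complex.ofReal_one]
    have hk : heckeTerm k (1 + t * Complex.I + ε) ω = r * z := by
      rw [← hr, ← heckeTerm_add, zero_add, add_right_comm]
    have h2k : heckeTerm (2 * k) (1 + (2 * t : ℝ) * Complex.I + ε) ω = r * z ^ 2 := by
      rw [← hr, sq, ← heckeTerm_add, ← heckeTerm_add]
      push_cast
      ring_nf
    rw [hr, hk, h2k, Complex.ofReal_re, Complex.re_ofReal_mul, Complex.re_ofReal_mul]
    calc 0 ≤ gaussianMangoldt ω * r * (3 + 4 * z.re + (z ^ 2).re) :=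
          mul_nonneg (mul_nonneg (gaussianMangoldt_nonneg ω) (norm_nonneg _))
            (three_add_four_mul_re_add_re_sq_nonneg hz)
      _ = _ := by ring
  all_goals simpa using hε

theorem HasOrderWithinAt.tendsto_mul_re_heckeMangoldt {k n : ℤ} {s₀ : ℂ} (hs₀ : s₀.re = 1)
    (h : HasOrderWithinAt (heckeL k) {s | 1 < s.re} s₀ n) :
    Tendsto (fun ε : ℝ ↦ ε * (heckeMangoldt k (s₀ + ε)).re) (𝓝[>] 0) (𝓝 (-2 * n)) := by
  obtain ⟨φ, hφ, hev⟩ := h.exists_heckeMangoldt_eq hs₀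
  exact tendsto_mul_re_of_eventually_eq_div_add hφ hev (by simp [hs₀])

theorem hasOrderWithinAt_heckeL_one_add_mul_I {h : ℤ} {t : ℝ} (hne : (h, t) ≠ (0, 0)) :
    HasOrderWithinAt (heckeL (4 * h)) {s | 1 < s.re} (1 + t * Complex.I) 0 := by
  obtain ⟨n, hn⟩ := exists_hasOrderWithinAt_heckeL_natCast hne
  obtain ⟨m, hm⟩ := exists_hasOrderWithinAt_heckeL_natCast
    (h := 2 * h) (t := 2 * t) (by simpa using hne)
  have hlim := (((hasOrderWithinAt_heckeL_zero_one.tendsto_mul_re_heckeMangoldt (by simp)).const_mul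
    3).add ((hn.tendsto_mul_re_heckeMangoldt (by simp)).const_mul 4)).add
      (hm.tendsto_mul_re_heckeMangoldt (by simp))
  have hnonneg : 0 ≤ 3 * (-2 * ((-1 : ℤ) : ℝ)) + 4 * (-2 * ((n : ℤ) : ℝ)) +
      -2 * ((m : ℤ) : ℝ) := by
    refine ge_of_tendsto hlim ?_
    filter_upwards [self_mem_nhdsWithin] with ε (hε : 0 < ε)
    have hpos := mul_nonneg hε.le (heckeMangoldt_three_four_one (4 * h) t hε)
    rw [mul_left_comm 2 4 h] at hpos
    linarith
  have hn₀ : (n : ℤ) = 0 := by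
    have hint : 0 ≤ 3 * (-2 * (-1)) + 4 * (-2 * (n : ℤ)) + -2 * m := by exact_mod_cast hnonneg
    omega
  rwa [hn₀] at hn

theorem exists_tendsto_heckeMangoldt {h : ℤ} {s₀ : ℂ} (hs₀ : 1 ≤ s₀.re) (hne : h ≠ 0 ∨ s₀ ≠ 1) :
    ∃ l, Tendsto (heckeMangoldt (4 * h)) (𝓝[{s | 1 < s.re}] s₀) (𝓝 l) := by
  rcases hs₀.lt_or_eq with hlt | heq
  · have hdiff := (dirichletSummable_gaussianMangoldt_mul_heckeChar (4 * h)).hasDerivAt hlt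
    exact ⟨_, hdiff.continuousAt.tendsto.mono_left nhdsWithin_le_nhds⟩
  · have hs : s₀ = 1 + s₀.im * Complex.I := by simp [Complex.ext_iff, ← heq]
    have hord : HasOrderWithinAt (heckeL (4 * h)) {s | 1 < s.re} s₀ 0 := by
      rw [hs]
      refine hasOrderWithinAt_heckeL_one_add_mul_I fun h0 ↦ ?_
      obtain ⟨h0, him⟩ := Prod.mk_inj.1 h0
      rw [hs, him] at hne
      simp [h0] at hne
    obtain ⟨φ, hφ, hev⟩ := hord.exists_heckeMangoldt_eq heq.symm
    refine ⟨φ s₀, (hφ.tendsto.mono_left nhdsWithin_le_nhds).congr' ?_⟩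
    filter_upwards [hev] with s hs
    rw [hs]
    simp

theorem extendsWithSimplePole_heckeMangoldt_zero : ExtendsWithSimplePole (heckeMangoldt 0) 2 := by
  intro s₀ hs₀
  rcases eq_or_ne s₀ 1 with rfl | hne
  · obtain ⟨φ, hφ, hev⟩ := hasOrderWithinAt_heckeL_zero_one.exists_heckeMangoldt_eq Complex.one_re
    refine ⟨φ 1, (hφ.tendsto.mono_left nhdsWithin_le_nhds).congr' ?_⟩
    filter_upwards [hev] with s hs
    rw [hs]
    simp
  · obtain ⟨l, hl⟩ := exists_tendsto_heckeMangoldt (h := 0) hs₀ (.inr hne)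
    have hpole : ContinuousAt (fun s : ℂ ↦ 2 / (s - 1)) s₀ :=
      continuousAt_const.div (by fun_prop) (sub_ne_zero.2 hne)
    exact ⟨_, hl.sub (hpole.tendsto.mono_left nhdsWithin_le_nhds)⟩

theorem extendsWithSimplePole_heckeMangoldt_of_ne_zero {h : ℤ} (hh : h ≠ 0) :
    ExtendsWithSimplePole (heckeMangoldt (4 * h)) 0 := fun _ hs₀ ↦ by
  simpa only [zero_div, sub_zero] using exists_tendsto_heckeMangoldt hs₀ (.inl hh)

/-! ### Sums over discs -/

instance : Countable GaussianInt :=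
  Function.Injective.countable (f := fun ω : GaussianInt ↦ (ω.re, ω.im)) fun _ _ h ↦
    Zsqrtd.ext (congrArg Prod.fst h) (congrArg Prod.snd h)

theorem summatory_logSq_log {E : Type*} [AddCommMonoid E] [TopologicalSpace E]
    {a : GaussianInt → E} (ha : a 0 = 0) {x : ℝ} (hx : 0 < x) :
    summatory a (fun ω ↦ logSq ω) (Real.log x) = ∑ ω ∈ gaussianDisc x, a ω := by
  have hterm (ω : GaussianInt) : (if logSq ω ≤ Real.log x then a ω else 0) =
      if ω ∈ gaussianDisc x then a ω else 0 := by
    rcases eq_or_ne ω 0 with rfl | hω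
    · simp [ha]
    · have hpos : 0 < ‖(ω : ℂ)‖ ^ 2 := pow_pos (by simpa using hω) 2
      have hlog : logSq ω = Real.log (‖(ω : ℂ)‖ ^ 2) := by rw [Real.log_pow, logSq, Nat.cast_ofNat]
      simp only [hlog, mem_gaussianDisc, Real.log_le_log_iff hpos hx]
  rw [summatory, tsum_congr hterm, tsum_eq_sum (s := gaussianDisc x) fun ω hω ↦ if_neg hω]
  exact Finset.sum_congr rfl fun ω hω ↦ if_pos hω

theorem extendsWithSimplePole_gaussianMangoldt :
    ExtendsWithSimplePole
      (dirichletSum (fun ω : GaussianInt ↦ gaussianMangoldt ω) fun ω ↦ logSq ω) 2 := by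
  convert extendsWithSimplePole_heckeMangoldt_zero using 1
  rw [heckeMangoldt]
  congr 1 with ω
  rcases eq_or_ne ω 0 with rfl | hω
  · simp [gaussianMangoldt_zero]
  · rw [heckeChar_of_ne_zero 0 (by simpa using hω), zpow_zero, mul_one]

theorem tendsto_inv_mul_gaussianPsi :
    Tendsto (fun x ↦ x⁻¹ * gaussianPsi x) atTop (𝓝 2) := by
  have hlim := (dirichletSummable_gaussianMangoldt.tendsto_summatory_of_nonneg
    gaussianMangoldt_nonneg (A := 2) (by exact_mod_cast
      extendsWithSimplePole_gaussianMangoldt)).comp Real.tendsto_log_atTop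
  refine hlim.congr' ?_
  filter_upwards [eventually_gt_atTop 0] with x hx
  rw [Function.comp_apply, summatory_logSq_log gaussianMangoldt_zero hx, Real.exp_neg,
    Real.exp_log hx, gaussianPsi]

theorem tendsto_inv_mul_sum_gaussianMangoldt_mul_heckeChar {h : ℤ} (hh : h ≠ 0) :
    Tendsto (fun x : ℝ ↦ ((x⁻¹ : ℝ) : ℂ) *
      ∑ ω ∈ gaussianDisc x, gaussianMangoldt ω * heckeChar (4 * h) ω) atTop (𝓝 0) := by
  have hlim := (dirichletSummable_gaussianMangoldt.tendsto_summatory_of_norm_le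
    (norm_gaussianMangoldt_mul_heckeChar_le (4 * h)) extendsWithSimplePole_gaussianMangoldt
    (extendsWithSimplePole_heckeMangoldt_of_ne_zero hh)).comp Real.tendsto_log_atTop
  refine hlim.congr' ?_
  filter_upwards [eventually_gt_atTop 0] with x hx
  rw [Function.comp_apply, summatory_logSq_log (by simp) hx, Real.exp_neg, Real.exp_log hx]

theorem exp_arg_mul_gaussianMangoldt (h : ℤ) (ω : GaussianInt) :
    Complex.exp (4 * Complex.I * (h : ℂ) * ((ω : ℂ).arg : ℂ)) * (gaussianMangoldt ω : ℂ) =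
      gaussianMangoldt ω * heckeChar (4 * h) ω := by
  rcases eq_or_ne ω 0 with rfl | hω
  · simp [gaussianMangoldt_zero]
  · rw [heckeChar_eq_exp _ (by simpa using hω), mul_comm]
    push_cast
    ring_nf

theorem proposition5p24 :
    gaussianPsi ~[atTop] (fun x : ℝ => 2 * x) ∧
    ∀ h : ℤ, h ≠ 0 →
      (fun x : ℝ => ∑ ω ∈ gaussianDisc x,
        Complex.exp (4 * Complex.I * (h : ℂ) * ((ω : ℂ).arg : ℂ)) * (gaussianMangoldt ω : ℂ))
        =o[atTop] (fun x : ℝ => x) := by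
  refine ⟨isEquivalent_of_tendsto_one ?_, fun h hh ↦ ?_⟩
  · have hlim := tendsto_inv_mul_gaussianPsi.div_const 2
    rw [div_self two_ne_zero] at hlim
    refine hlim.congr fun x ↦ ?_
    rw [Pi.div_apply]
    ring
  · simp only [exp_arg_mul_gaussianMangoldt]
    rw [← isLittleO_norm_left, isLittleO_iff_tendsto' ?_]
    · refine norm_zero (E := ℂ) ▸
        (tendsto_inv_mul_sum_gaussianMangoldt_mul_heckeChar hh).norm.congr' ?_
      filter_upwards [eventually_ge_atTop 0] with x hx
      rw [norm_mul, Complex.norm_of_nonneg (inv_nonneg.2 hx), inv_mul_eq_div]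
    · filter_upwards [eventually_ne_atTop 0] with x hx h0
      exact absurd h0 hx
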